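/- Let $A$ be a C$^*$-algebra with multiplier algebra $M(A)$. A strongly continuous one-parameter representation on $A$ is a family $\alpha=(\alpha_t)_{t\in\mathbb R}$ of bounded linear operators on $A$ with $\alpha_{s+t}=\alpha_s\alpha_t$, $\alpha_0=\mathrm{id}$, $\|\alpha_t\|\le 1$, such that $t\mapsto\alpha_t(a)$ is norm continuous for every $a\in A$. It is called semi-multiplicative if there are strongly continuous one-parameter representations $\beta,\gamma$ on $A$ with $\beta_t(b)\,\alpha_t(a)=\alpha_t(ba)$ and $\alpha_t(a)\,\gamma_t(b)=\alpha_t(ab)$ for all $a,b\in A$, $t\in\mathbb R$ (for example, every strongly continuous one-parameter group of $*$-automorphisms of $A$ is semi-multiplicative). The strict topology on $M(A)$ is the coarsest topology for which all maps $m\mapsto mb$ and $m\mapsto bm$ ($b\in A$) from $M(A)$ into $A$ with its norm topology are continuous. If $\alpha$ is semi-multiplicative, each $\alpha_t$ has a unique linear extension $\overline{\alpha_t}:M(A)\to M(A)$ that is strictly continuous on norm bounded subsets of $M(A)$. For $z\in\mathbb C$ let $S(z)$ be the closed horizontal strip of all $y\in\mathbb C$ with $\operatorname{Im}y$ between $0$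 and $\operatorname{Im}z$ (inclusive), and $S(z)^0$ its interior. Let $\alpha_z$ be the linear operator in $A$ whose domain $D(\alpha_z)$ consists of the $a\in A$ for which there is a function $f:S(z)\to A$ that is norm continuous on $S(z)$, analytic on $S(z)^0$ and satisfies $f(t)=\alpha_t(a)$ for all $t\in\mathbb R$, with $\alpha_z(a)=f(z)$. Let $\overline{\alpha}_z$ be the linear operator in $M(A)$ whose domain consists of the $a\in M(A)$ for which there is a function $f:S(z)\to M(A)$ that is strictly continuous on $S(z)$, (norm) analytic on $S(z)^0$ and satisfies $f(t)=\overline{\alpha_t}(a)$ for all $t\in\mathbb R$, with $\overline{\alpha}_z(a)=f(z)$. In both cases $f$ is unique. **Theorem.** Let $\alpha$ be a strongly continuous, semi-multiplicative one-parameter representation on a C$^*$-algebra $A$, and let $z\in\mathbb C$. Then $\overline{\alpha}_z$ is strictly closed, i.e. its graph is closed in $M(A)\times M(A)$ for the product of the strict topologies, and $D(\alpha_z)\subseteq A\subseteq M(A)$ is a strict core for $\overline{\alpha}_z$. Moreover $\alpha_z$, regarded as an operator in $M(A)$, is strictly closable, and its strict closure $\tau_z$ equals $\overline{\alpha}_z$.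 -/

import Mathlib

open scoped MultiplierAlgebra Topology

namespace StrictContinuation

/-! ### One-parameter representations -/

/-- A one-parameter representation on `E`: a group homomorphism from `ℝ` into the contractions
of `E`. -/
structure OneParamRep (E : Type*) [NormedAddCommGroup E] [NormedSpace ℂ E] where
  toFun : ℝ → E →L[ℂ] E
  map_add : ∀ s t, toFun (s + t) = (toFun s).comp (toFun t)
  map_zero : toFun 0 = ContinuousLinearMap.id ℂ E
  norm_le_one : ∀ t, ‖toFun t‖ ≤ 1

instance {E : Type*} [NormedAddCommGroup E] [NormedSpace ℂ E] :
    CoeFun (OneParamRep E) (fun _ => ℝ → E →L[ℂ] E) := ⟨OneParamRep.toFun⟩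

/-- Strong continuity: every orbit map is norm continuous. -/
def OneParamRep.StronglyContinuous {E : Type*} [NormedAddCommGroup E] [NormedSpace ℂ E]
    (α : OneParamRep E) : Prop :=
  ∀ a : E, Continuous fun t : ℝ => α t a

/-- Semi-multiplicativity of a one-parameter representation on a C⋆-algebra. -/
def OneParamRep.SemiMultiplicative {A : Type*} [NonUnitalCStarAlgebra A]
    (α : OneParamRep A) : Prop :=
  ∃ β γ : OneParamRep A, β.StronglyContinuous ∧ γ.StronglyContinuous ∧
    ∀ (t : ℝ) (a b : A), β t b * α t a = α t (b * a) ∧ α t a * γ t b = α t (a * b)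

theorem OneParamRep.apply_neg_apply {E : Type*} [NormedAddCommGroup E] [NormedSpace ℂ E]
    (α : OneParamRep E) (t : ℝ) (a : E) : α t (α (-t) a) = a := by
  have h := α.map_add t (-t)
  rw [add_neg_cancel, α.map_zero] at h
  exact (DFunLike.congr_fun h a).symm

/-- Multiplicative representations, e.g. groups of ⋆-automorphisms, are semi-multiplicative. -/
theorem OneParamRep.SemiMultiplicative.of_map_mul {A : Type*} [NonUnitalCStarAlgebra A]
    {α : OneParamRep A} (hα : α.StronglyContinuous)
    (hmul : ∀ (t : ℝ) (a b : A), α t (a * b) = α t a * α t b) : α.SemiMultiplicative :=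
  ⟨α, α, hα, hα, fun t a b => ⟨(hmul t b a).symm, (hmul t a b).symm⟩⟩

/-! ### The closed horizontal strip and uniqueness of analytic continuation -/

/-- The closed horizontal strip between the real axis and the horizontal line through `z`
(above or below the real axis, according to the sign of `Im z`). -/
def strip (z : ℂ) : Set ℂ := {y | y.im ∈ Set.uIcc 0 z.im}

theorem ofReal_mem_strip (z : ℂ) (t : ℝ) : (t : ℂ) ∈ strip z := by simp [strip]

theorem self_mem_strip (z : ℂ) : z ∈ strip z := by simp [strip]

theorem interior_strip (z : ℂ) : interior (strip z) =
    {y : ℂ | y.im ∈ Set.Ioo (min 0 z.im) (max 0 z.im)} := by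
  have : strip z = Complex.im ⁻¹' Set.Icc (min 0 z.im) (max 0 z.im) := rfl
  rw [this, Complex.interior_preimage_im, interior_Icc]
  rfl

/-- A function vanishing on the bottom side of a square vanishes at its centre. -/
theorem eq_zero_at_center {f : ℂ → ℂ} {h : ℝ}
    (hc : ContinuousOn f {w : ℂ | w.im ∈ Set.Icc 0 h})
    (hd : DifferentiableOn ℂ f {w : ℂ | w.im ∈ Set.Ioo 0 h})
    (h0 : ∀ t : ℝ, f t = 0) (p : ℂ) (hp : 0 < p.im) (hp' : 2 * p.im ≤ h) : f p = 0 := by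
  set s := p.im with hs
  set Q : Set ℂ := Set.Ioo (-s) s ×ℂ Set.Ioo (-s) s with hQ
  have hcl : closure Q = Set.Icc (-s) s ×ℂ Set.Icc (-s) s := by
    rw [hQ, Complex.closure_reProdIm, closure_Ioo (by linarith)]
  have hQo : IsOpen Q := isOpen_Ioo.reProdIm isOpen_Ioo
  have key : ∀ c : ℂ, (∀ u ∈ closure Q, c * u ∈ closure Q) → (∀ u ∈ Q, c * u ∈ Q) →
      DiffContOnCl ℂ (fun u => f (p + c * u)) Q := by
    intro c h1 h2
    refine ⟨?_, ?_⟩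
    · refine hd.comp (by fun_prop) ?_
      intro u hu
      have := (h2 u hu).2
      simp only [Set.mem_preimage, Set.mem_Ioo] at this
      simp only [Set.mem_ofPred_eq, Complex.add_im, Set.mem_Ioo]
      constructor <;> linarith [this.1, this.2]
    · refine hc.comp (by fun_prop) ?_
      intro u hu
      have hcu := h1 u hu
      rw [hcl] at hcu
      have := hcu.2
      simp only [Set.mem_preimage, Set.mem_Icc] at this
      simp only [Set.mem_ofPred_eq, Complex.add_im, Set.mem_Icc]
      constructor <;> linarith [this.1, this.2]
  have k1 := key 1 (by simp) (by simp)
  have k2 := key Complex.I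
    (by rw [hcl]; intro u hu; simp only [Complex.mem_reProdIm, Set.mem_Icc] at hu ⊢
        simp; grind)
    (by intro u hu; simp only [hQ, Complex.mem_reProdIm, Set.mem_Ioo] at hu ⊢
        simp; grind)
  have k3 := key (-1)
    (by rw [hcl]; intro u hu; simp only [Complex.mem_reProdIm, Set.mem_Icc] at hu ⊢
        simp; grind)
    (by intro u hu; simp only [hQ, Complex.mem_reProdIm, Set.mem_Ioo] at hu ⊢
        simp; grind)
  have k4 := key (-Complex.I)
    (by rw [hcl]; intro u hu; simp only [Complex.mem_reProdIm, Set.mem_Icc] at hu ⊢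
        simp; grind)
    (by intro u hu; simp only [hQ, Complex.mem_reProdIm, Set.mem_Ioo] at hu ⊢
        simp; grind)
  have kF := ((k1.smul k2).smul k3).smul k4
  have hb : Bornology.IsBounded Q := by
    exact (Metric.isBounded_Ioo _ _).reProdIm (Metric.isBounded_Ioo _ _)
  have hz : ∀ w : ℂ, w.im = 0 → f w = 0 := by
    intro w hw
    rw [← h0 w.re]
    congr 1
    exact Complex.ext (by simp) (by simp [hw])
  have hE := Complex.eqOn_of_eqOn_frontier hb kF (diffContOnCl_const (c := (0 : ℂ))) (by
    intro u hu
    rw [frontier, hQo.interior_eq, hcl, hQ] at hu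
    simp only [Set.mem_sdiff, Complex.mem_reProdIm, Set.mem_Icc, Set.mem_Ioo] at hu
    obtain ⟨⟨⟨a1, a2⟩, b1, b2⟩, hn⟩ := hu
    simp only [smul_eq_mul, mul_eq_zero]
    have : u.re = -s ∨ u.re = s ∨ u.im = -s ∨ u.im = s := by grind
    rcases this with e | e | e | e
    · exact Or.inl (Or.inl (Or.inr (hz _ (by simp [e, ← hs]))))
    · exact Or.inr (hz _ (by simp [e, ← hs]))
    · exact Or.inl (Or.inl (Or.inl (hz _ (by simp [e, ← hs]))))
    · exact Or.inl (Or.inr (hz _ (by simp [e, ← hs]))))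
  have h00 : (0 : ℂ) ∈ Q := by simp [hQ, Complex.mem_reProdIm, hp]
  have := hE h00
  simpa using this

theorem eqOn_zero_of_scalar {f : ℂ → ℂ} {h : ℝ} (hh : 0 < h)
    (hc : ContinuousOn f {w : ℂ | w.im ∈ Set.Icc 0 h})
    (hd : AnalyticOnNhd ℂ f {w : ℂ | w.im ∈ Set.Ioo 0 h})
    (h0 : ∀ t : ℝ, f t = 0) : Set.EqOn f 0 {w : ℂ | w.im ∈ Set.Icc 0 h} := by
  have hpre : IsPreconnected {w : ℂ | w.im ∈ Set.Ioo 0 h} := by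
    have : Convex ℝ (Complex.im ⁻¹' Set.Ioo 0 h) :=
      (convex_Ioo 0 h).is_linear_preimage (f := Complex.im) Complex.imLm.isLinear
    exact this.isPreconnected
  have hev : f =ᶠ[𝓝 (⟨0, h / 4⟩ : ℂ)] 0 := by
    have ho : IsOpen {w : ℂ | w.im ∈ Set.Ioo 0 (h / 2)} :=
      isOpen_Ioo.preimage Complex.continuous_im
    filter_upwards [ho.mem_nhds (show (⟨0, h / 4⟩ : ℂ) ∈ _ by
      simp only [Set.mem_ofPred_eq, Set.mem_Ioo]; constructor <;> linarith)] with w hw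
    exact eq_zero_at_center hc hd.differentiableOn h0 w hw.1 (by linarith [hw.2])
  have hin : Set.EqOn f 0 {w : ℂ | w.im ∈ Set.Ioo 0 h} :=
    hd.eqOn_zero_of_preconnected_of_eventuallyEq_zero hpre
      (show (⟨0, h / 4⟩ : ℂ) ∈ _ by
        simp only [Set.mem_ofPred_eq, Set.mem_Ioo]; constructor <;> linarith) hev
  refine hin.of_subset_closure hc continuousOn_const
    (fun w hw => Set.Ioo_subset_Icc_self hw) ?_
  have : closure (Complex.im ⁻¹' Set.Ioo 0 h) = Complex.im ⁻¹' Set.Icc 0 h := by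
    rw [Complex.closure_preimage_im, closure_Ioo hh.ne]
  exact this.ge

/-- A function that is continuous on a strip, analytic on its interior and zero on the real axis
vanishes on the strip. -/
theorem eqOn_zero_strip {E : Type*} [NormedAddCommGroup E] [NormedSpace ℂ E] {f : ℂ → E} {z : ℂ}
    (hc : ContinuousOn f (strip z)) (hd : AnalyticOnNhd ℂ f (interior (strip z)))
    (h0 : ∀ t : ℝ, f t = 0) : Set.EqOn f 0 (strip z) := by
  intro w hw
  refine SeparatingDual.eq_zero_of_forall_dual_eq_zero (R := ℂ) fun l => ?_
  rw [interior_strip] at hd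
  have hld : AnalyticOnNhd ℂ (fun u => l (f u)) _ := fun u hu => (l.analyticAt _).comp (hd u hu)
  have hlc : ContinuousOn (fun u => l (f u)) _ := l.continuous.comp_continuousOn hc
  have hl0 : ∀ t : ℝ, l (f t) = 0 := fun t => by rw [h0, map_zero]
  rcases lt_trichotomy z.im 0 with hz | hz | hz
  · have e : Set.uIcc 0 z.im = Set.Icc z.im 0 := Set.uIcc_of_ge hz.le
    simp only [strip, e] at hlc hw
    rw [min_eq_right hz.le, max_eq_left hz.le] at hld
    have := eqOn_zero_of_scalar (f := fun u => l (f (-u))) (h := -z.im) (by linarith)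
      (hlc.comp continuous_neg.continuousOn (fun u hu => by
        simp only [Set.mem_ofPred_eq, Set.mem_Icc, Complex.neg_im] at hu ⊢
        constructor <;> linarith [hu.1, hu.2]))
      (hld.comp (g := fun u => l (f u)) (f := fun u : ℂ => -u) (analyticOnNhd_id.neg)
        (fun u hu => by
        simp only [Set.mem_ofPred_eq, Set.mem_Ioo, Complex.neg_im] at hu ⊢
        constructor <;> linarith [hu.1, hu.2]))
      (fun t => by simpa using hl0 (-t))
    have h2 := this (x := -w) (by
      simp only [Set.mem_ofPred_eq, Set.mem_Icc, Complex.neg_im] at hw ⊢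
      constructor <;> linarith [hw.1, hw.2])
    simpa using h2
  · simp only [strip, hz, Set.uIcc_self, Set.mem_singleton_iff, Set.mem_ofPred_eq] at hw
    have : w = (w.re : ℂ) := Complex.ext (by simp) (by simp [hw])
    rw [this]; exact hl0 _
  · have e : Set.uIcc 0 z.im = Set.Icc 0 z.im := Set.uIcc_of_le hz.le
    simp only [strip, e] at hlc hw
    rw [min_eq_left hz.le, max_eq_right hz.le] at hld
    exact eqOn_zero_of_scalar hz hlc hld hl0 hw

/-! ### The norm analytic continuation on a Banach space -/

/-- `f` continues the orbit `t ↦ α_t(a)` to the strip `S(z)`. -/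
structure IsContinuation {E : Type*} [NormedAddCommGroup E] [NormedSpace ℂ E]
    (α : OneParamRep E) (z : ℂ) (a : E) (f : ℂ → E) : Prop where
  continuousOn : ContinuousOn f (strip z)
  analyticOn : AnalyticOnNhd ℂ f (interior (strip z))
  eq_real : ∀ t : ℝ, α t a = f t

/-- The graph of `α_z`: the pairs `(a, f z)` where `f` continues the orbit of `a` to `S(z)`. -/
def analyticGraph {E : Type*} [NormedAddCommGroup E] [NormedSpace ℂ E]
    (α : OneParamRep E) (z : ℂ) : Submodule ℂ (E × E) where
  carrier := {p | ∃ f : ℂ → E, IsContinuation α z p.1 f ∧ f z = p.2}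
  zero_mem' := ⟨0, ⟨continuousOn_const, analyticOnNhd_const, by simp⟩, rfl⟩
  add_mem' := by
    rintro _ _ ⟨f, hf, hfz⟩ ⟨g, hg, hgz⟩
    exact ⟨f + g, ⟨hf.continuousOn.add hg.continuousOn, hf.analyticOn.add hg.analyticOn,
      fun t => by simp [hf.eq_real, hg.eq_real]⟩, by simp [hfz, hgz]⟩
  smul_mem' := by
    rintro c _ ⟨f, hf, hfz⟩
    exact ⟨c • f, ⟨hf.continuousOn.const_smul c, fun w hw => (hf.analyticOn w hw).const_smul,
      fun t => by simp [hf.eq_real]⟩, by simp [hfz]⟩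

/-- The analytic continuation `α_z`, an operator in `E`. -/
noncomputable def analyticCont {E : Type*} [NormedAddCommGroup E] [NormedSpace ℂ E]
    (α : OneParamRep E) (z : ℂ) : E →ₗ.[ℂ] E :=
  (analyticGraph α z).toLinearPMap

/-- `α_z` is well defined: its graph is the set of pairs by which it was defined. -/
theorem analyticCont_graph {E : Type*} [NormedAddCommGroup E] [NormedSpace ℂ E]
    (α : OneParamRep E) (z : ℂ) : (analyticCont α z).graph = analyticGraph α z := by
  refine Submodule.toLinearPMap_graph_eq _ ?_
  rintro ⟨a, b⟩ ⟨f, hf, hfz⟩ ha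
  simp only at ha hf hfz
  subst ha
  rw [← hfz]
  exact eqOn_zero_strip hf.continuousOn hf.analyticOn (fun t => by simp [← hf.eq_real])
    (self_mem_strip z)

/-! ### The strict topology on the multiplier algebra -/

/-- The multiplier algebra `M(A)`, as a type synonym that carries the strict topology instead of
the norm topology. -/
def StrictMultiplier (A : Type*) [NonUnitalCStarAlgebra A] : Type _ := 𝓜(ℂ, A)

noncomputable instance (A : Type*) [NonUnitalCStarAlgebra A] : AddCommGroup (StrictMultiplier A) :=
  inferInstanceAs (AddCommGroup 𝓜(ℂ, A))

noncomputable instance (A : Type*) [NonUnitalCStarAlgebra A] : Module ℂ (StrictMultiplier A) :=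
  inferInstanceAs (Module ℂ 𝓜(ℂ, A))

/-- The identity map from `M(A)` to its type synonym. -/
noncomputable def toStrict (A : Type*) [NonUnitalCStarAlgebra A] :
    𝓜(ℂ, A) ≃ₗ[ℂ] StrictMultiplier A :=
  LinearEquiv.refl ℂ 𝓜(ℂ, A)

/-- A multiplier `m` seen as the pair of maps `b ↦ m b` and `b ↦ b m` on `A`. -/
noncomputable def actions (A : Type*) [NonUnitalCStarAlgebra A] :
    StrictMultiplier A →ₗ[ℂ] (A → A) × (A → A) where
  toFun m := (fun b => ((toStrict A).symm m).fst b, fun b => ((toStrict A).symm m).snd b)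
  map_add' m n := by simp only [map_add]; rfl
  map_smul' c m := by simp only [map_smul]; rfl

/-- The strict topology: the coarsest topology for which all the maps `m ↦ m b` and `m ↦ b m`,
`b ∈ A`, into `A` with its norm topology, are continuous. -/
noncomputable instance (A : Type*) [NonUnitalCStarAlgebra A] : TopologicalSpace (StrictMultiplier A) :=
  TopologicalSpace.induced (actions A) inferInstance

instance (A : Type*) [NonUnitalCStarAlgebra A] : ContinuousAdd (StrictMultiplier A) :=
  continuousAdd_induced (actions A)

instance (A : Type*) [NonUnitalCStarAlgebra A] : ContinuousSMul ℂ (StrictMultiplier A) :=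
  continuousSMul_induced (actions A)

theorem tendsto_strict_iff {A : Type*} [NonUnitalCStarAlgebra A] {ι : Type*} {l : Filter ι}
    {f : ι → 𝓜(ℂ, A)} {m : 𝓜(ℂ, A)} :
    Filter.Tendsto (fun i => toStrict A (f i)) l (𝓝 (toStrict A m)) ↔
      (∀ b, Filter.Tendsto (fun i => (f i).fst b) l (𝓝 (m.fst b))) ∧
      (∀ b, Filter.Tendsto (fun i => (f i).snd b) l (𝓝 (m.snd b))) := by
  rw [nhds_induced, Filter.tendsto_comap_iff, Prod.tendsto_iff, tendsto_pi_nhds, tendsto_pi_nhds]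
  rfl

/-- The embedding of `A` into `M(A)`. -/
noncomputable def embed (A : Type*) [NonUnitalCStarAlgebra A] : A →ₗ[ℂ] StrictMultiplier A :=
  (toStrict A).toLinearMap ∘ₗ
    ((DoubleCentralizer.coeHom : A →⋆ₙₐ[ℂ] 𝓜(ℂ, A)) : A →ₗ[ℂ] 𝓜(ℂ, A))

theorem embed_apply {A : Type*} [NonUnitalCStarAlgebra A] (a : A) :
    embed A a = toStrict A (a : 𝓜(ℂ, A)) := rfl

theorem eq_zero_of_forall_mul {A : Type*} [NonUnitalCStarAlgebra A] {a : A}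
    (h : ∀ c : A, c * a = 0) : a = 0 :=
  CStarRing.star_mul_self_eq_zero_iff a |>.1 (h _)

theorem embed_injective (A : Type*) [NonUnitalCStarAlgebra A] :
    Function.Injective (embed A) := by
  refine (injective_iff_map_eq_zero _).2 fun a ha => eq_zero_of_forall_mul fun c => ?_
  rw [embed_apply, LinearEquiv.map_eq_zero_iff] at ha
  have : (a : 𝓜(ℂ, A)).snd c = 0 := by rw [ha]; simp
  simpa using this

/-- An operator in `A` seen as an operator in `M(A)`, with the same domain and values. -/
noncomputable def embedOperator {A : Type*} [NonUnitalCStarAlgebra A] (T : A →ₗ.[ℂ] A) :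
    StrictMultiplier A →ₗ.[ℂ] StrictMultiplier A :=
  (T.graph.map ((embed A).prodMap (embed A))).toLinearPMap

theorem embedOperator_graph {A : Type*} [NonUnitalCStarAlgebra A] (T : A →ₗ.[ℂ] A) :
    (embedOperator T).graph = T.graph.map ((embed A).prodMap (embed A)) := by
  refine Submodule.toLinearPMap_graph_eq _ ?_
  rintro _ ⟨⟨a, b⟩, hab, rfl⟩ h
  simp only [LinearMap.prodMap_apply] at h ⊢
  have ha : a = 0 := embed_injective A (by simpa using h)
  rw [T.graph_fst_eq_zero_snd hab ha, map_zero]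

/-! ### Strict extension of linear maps to the multiplier algebra -/

/-- `θ` is a linear map on `M(A)` that extends `ρ` and is strictly continuous on norm bounded
subsets of `M(A)`. -/
structure IsStrictExtension {A : Type*} [NonUnitalCStarAlgebra A] (ρ : A →L[ℂ] A)
    (θ : 𝓜(ℂ, A) →ₗ[ℂ] 𝓜(ℂ, A)) : Prop where
  extends_coe : ∀ a : A, θ (a : 𝓜(ℂ, A)) = ((ρ a : A) : 𝓜(ℂ, A))
  continuousOn_bounded : ∀ S : Set 𝓜(ℂ, A), Bornology.IsBounded S →
    ContinuousOn (fun m => toStrict A (θ ((toStrict A).symm m))) (toStrict A '' S)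

theorem fst_mul {A : Type*} [NonUnitalCStarAlgebra A] (m : 𝓜(ℂ, A)) (x y : A) :
    m.fst (x * y) = m.fst x * y := by
  rw [← sub_eq_zero]
  refine eq_zero_of_forall_mul fun c => ?_
  rw [mul_sub, ← m.central, ← mul_assoc c, ← m.central, mul_assoc, sub_self]

theorem multiplier_ext {A : Type*} [NonUnitalCStarAlgebra A] {m n : 𝓜(ℂ, A)}
    (h₁ : ∀ b, m.fst b = n.fst b) (h₂ : ∀ b, m.snd b = n.snd b) : m = n :=
  DoubleCentralizer.ext _ _ _ _
    (Prod.ext (ContinuousLinearMap.ext h₁) (ContinuousLinearMap.ext h₂))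

theorem IsStrictExtension.unique {A : Type*} [NonUnitalCStarAlgebra A] {ρ : A →L[ℂ] A}
    {θ θ' : 𝓜(ℂ, A) →ₗ[ℂ] 𝓜(ℂ, A)} (h : IsStrictExtension ρ θ) (h' : IsStrictExtension ρ θ') :
    θ = θ' := by
  let _ := CStarAlgebra.spectralOrder A
  let _ := CStarAlgebra.spectralOrderedRing A
  have hu := CStarAlgebra.increasingApproximateUnit A
  have := hu.neBot
  ext1 m
  set l := CStarAlgebra.approximateUnit A
  have hm : Filter.Tendsto (fun e => toStrict A ((m.fst e : A) : 𝓜(ℂ, A))) l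
      (𝓝 (toStrict A m)) := by
    rw [tendsto_strict_iff]
    refine ⟨fun b => ?_, fun b => ?_⟩
    · simp only [DoubleCentralizer.coe_fst, ContinuousLinearMap.mul_apply', ← fst_mul]
      exact (m.fst.continuous.tendsto b).comp (hu.tendsto_mul_right b)
    · simp only [DoubleCentralizer.coe_snd, ContinuousLinearMap.flip_apply,
        ContinuousLinearMap.mul_apply', ← m.central]
      exact hu.tendsto_mul_left _
  have hS : ∀ᶠ e in l, ((m.fst e : A) : 𝓜(ℂ, A)) ∈ Metric.closedBall (0 : 𝓜(ℂ, A)) ‖m‖ := by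
    filter_upwards [hu.eventually_norm] with e he
    rw [mem_closedBall_zero_iff, ← DoubleCentralizer.norm_fst, DoubleCentralizer.coe_fst]
    refine (ContinuousLinearMap.opNorm_mul_apply_le ℂ A _).trans ?_
    refine (m.fst.le_opNorm e).trans ?_
    rw [DoubleCentralizer.norm_fst]
    exact mul_le_of_le_one_right (norm_nonneg _) he
  have lim : ∀ {η : 𝓜(ℂ, A) →ₗ[ℂ] 𝓜(ℂ, A)}, IsStrictExtension ρ η →
      Filter.Tendsto (fun e => toStrict A ((ρ (m.fst e) : A) : 𝓜(ℂ, A))) l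
        (𝓝 (toStrict A (η m))) := by
    intro η hη
    have hc := hη.continuousOn_bounded _ (Metric.isBounded_closedBall (x := 0) (r := ‖m‖))
      (toStrict A m) ⟨m, by simp, rfl⟩
    have := hc.tendsto.comp (tendsto_nhdsWithin_iff.2
      ⟨hm, hS.mono fun e he => Set.mem_image_of_mem _ he⟩)
    simpa [Function.comp_def, hη.extends_coe] using this
  have h1 := tendsto_strict_iff.1 (lim h)
  have h2 := tendsto_strict_iff.1 (lim h')
  exact multiplier_ext (fun b => tendsto_nhds_unique (h1.1 b) (h2.1 b))
    (fun b => tendsto_nhds_unique (h1.2 b) (h2.2 b))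

/-- The maps of a semi-multiplicative representation have unique strict extensions. -/
theorem OneParamRep.SemiMultiplicative.existsUnique_strictExtension {A : Type*}
    [NonUnitalCStarAlgebra A] {α : OneParamRep A} (hα : α.SemiMultiplicative) (t : ℝ) :
    ∃! θ : 𝓜(ℂ, A) →ₗ[ℂ] 𝓜(ℂ, A), IsStrictExtension (α t) θ := by
  obtain ⟨β, γ, -, -, hm⟩ := hα
  refine existsUnique_of_exists_of_unique ?_ fun _ _ h h' => h.unique h'
  refine ⟨{ toFun := fun m =>
              { fst := (α t).comp (m.fst.comp (γ (-t)))
                snd := (α t).comp (m.snd.comp (β (-t)))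
                central := ?_ }
            map_add' := ?_
            map_smul' := ?_ }, ?_, ?_⟩
  · intro x y
    simp only [ContinuousLinearMap.comp_apply]
    nth_rw 2 [← β.apply_neg_apply t x]
    nth_rw 1 [← γ.apply_neg_apply t y]
    rw [(hm t _ _).1, (hm t _ _).2, m.central]
  · intro m n
    exact multiplier_ext (fun b => by simp) (fun b => by simp)
  · intro c m
    exact multiplier_ext (fun b => by simp) (fun b => by simp)
  · intro a
    refine multiplier_ext (fun b => ?_) (fun b => ?_)
    · simp [← (hm t _ _).2, γ.apply_neg_apply]
    · simp [← (hm t _ _).1, β.apply_neg_apply]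
  · intro S _
    refine Continuous.continuousOn (continuous_iff_continuousAt.2 fun m => ?_)
    have hid : Filter.Tendsto (fun n => toStrict A ((toStrict A).symm n)) (𝓝 m)
        (𝓝 (toStrict A ((toStrict A).symm m))) := by
      simp only [LinearEquiv.apply_symm_apply]
      exact Filter.tendsto_id
    rw [tendsto_strict_iff] at hid
    refine tendsto_strict_iff.2 ⟨fun b => ?_, fun b => ?_⟩
    · exact ((α t).continuous.tendsto _).comp (hid.1 _)
    · exact ((α t).continuous.tendsto _).comp (hid.2 _)

/-- The map on `M(A)` obtained from `α_t`: the unique strict extension of `α_t`. -/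
noncomputable def strictExt {A : Type*} [NonUnitalCStarAlgebra A] {α : OneParamRep A}
    (hα : α.SemiMultiplicative) (t : ℝ) : 𝓜(ℂ, A) →ₗ[ℂ] 𝓜(ℂ, A) :=
  (hα.existsUnique_strictExtension t).choose

theorem isStrictExtension_strictExt {A : Type*} [NonUnitalCStarAlgebra A] {α : OneParamRep A}
    (hα : α.SemiMultiplicative) (t : ℝ) : IsStrictExtension (α t) (strictExt hα t) :=
  (hα.existsUnique_strictExtension t).choose_spec.1

/-! ### The strict analytic continuation on the multiplier algebra -/

/-- `f` is a strictly continuous, norm analytic continuation of the orbit `t ↦ α_t(a)`,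
`a ∈ M(A)`, to the strip `S(z)`. -/
structure IsStrictContinuation {A : Type*} [NonUnitalCStarAlgebra A] {α : OneParamRep A}
    (hα : α.SemiMultiplicative) (z : ℂ) (a : 𝓜(ℂ, A)) (f : ℂ → 𝓜(ℂ, A)) : Prop where
  continuousOn : ContinuousOn (fun y => toStrict A (f y)) (strip z)
  analyticOn : AnalyticOnNhd ℂ f (interior (strip z))
  eq_real : ∀ t : ℝ, strictExt hα t a = f t

/-- The graph of the strict analytic continuation at `z`. -/
def strictGraph {A : Type*} [NonUnitalCStarAlgebra A] {α : OneParamRep A}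
    (hα : α.SemiMultiplicative) (z : ℂ) : Submodule ℂ (StrictMultiplier A × StrictMultiplier A) where
  carrier := {p | ∃ f : ℂ → 𝓜(ℂ, A),
    IsStrictContinuation hα z ((toStrict A).symm p.1) f ∧ toStrict A (f z) = p.2}
  zero_mem' := ⟨0, ⟨continuousOn_const, analyticOnNhd_const, by simp⟩, by simp⟩
  add_mem' := by
    rintro _ _ ⟨f, hf, hfz⟩ ⟨g, hg, hgz⟩
    refine ⟨f + g, ⟨?_, hf.analyticOn.add hg.analyticOn,
      fun t => by simp [hf.eq_real, hg.eq_real]⟩, by simp [hfz, hgz]⟩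
    simp only [Pi.add_apply, map_add]
    exact hf.continuousOn.add hg.continuousOn
  smul_mem' := by
    rintro c _ ⟨f, hf, hfz⟩
    refine ⟨c • f, ⟨?_, fun w hw => (hf.analyticOn w hw).const_smul,
      fun t => by simp [hf.eq_real]⟩, by simp [hfz]⟩
    simp only [Pi.smul_apply, map_smul]
    exact (continuousOn_const (c := c)).smul hf.continuousOn

/-- The strict analytic continuation at `z`, an operator in `M(A)`. -/
noncomputable def strictCont {A : Type*} [NonUnitalCStarAlgebra A] {α : OneParamRep A}
    (hα : α.SemiMultiplicative) (z : ℂ) : StrictMultiplier A →ₗ.[ℂ] StrictMultiplier A :=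
  (strictGraph hα z).toLinearPMap

/-- The strict analytic continuation is well defined. -/
theorem strictCont_graph {A : Type*} [NonUnitalCStarAlgebra A] {α : OneParamRep A}
    (hα : α.SemiMultiplicative) (z : ℂ) : (strictCont hα z).graph = strictGraph hα z := by
  refine Submodule.toLinearPMap_graph_eq _ ?_
  rintro ⟨a, b⟩ ⟨f, hf, hfz⟩ ha
  simp only at ha hf hfz
  subst ha
  rw [← hfz, LinearEquiv.map_eq_zero_iff]
  have h0 : ∀ t : ℝ, f t = 0 := fun t => by simp [← hf.eq_real]
  have hc := fun w hw => tendsto_strict_iff.1 (hf.continuousOn w hw)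
  have ev₁ : ∀ c : A, ∃ L : 𝓜(ℂ, A) →L[ℂ] A, ∀ m, L m = m.fst c := fun c =>
    ⟨LinearMap.mkContinuous
      { toFun := fun m => m.fst c, map_add' := fun _ _ => rfl, map_smul' := fun _ _ => rfl } ‖c‖
      (fun m => by
        rw [mul_comm, ← DoubleCentralizer.norm_fst]
        exact m.fst.le_opNorm c), fun m => rfl⟩
  have ev₂ : ∀ c : A, ∃ L : 𝓜(ℂ, A) →L[ℂ] A, ∀ m, L m = m.snd c := fun c =>
    ⟨LinearMap.mkContinuous
      { toFun := fun m => m.snd c, map_add' := fun _ _ => rfl, map_smul' := fun _ _ => rfl } ‖c‖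
      (fun m => by
        rw [mul_comm, ← DoubleCentralizer.norm_snd]
        exact m.snd.le_opNorm c), fun m => rfl⟩
  refine multiplier_ext (fun c => ?_) (fun c => ?_)
  · obtain ⟨L, hL⟩ := ev₁ c
    have := eqOn_zero_strip (f := fun w => L (f w)) (z := z)
      (fun w hw => by simp only [hL]; exact (hc w hw).1 c)
      (fun w hw => (L.analyticAt _).comp (hf.analyticOn w hw)) (fun t => by simp [h0])
      (self_mem_strip z)
    simpa [hL] using this
  · obtain ⟨L, hL⟩ := ev₂ c
    have := eqOn_zero_strip (f := fun w => L (f w)) (z := z)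
      (fun w hw => by simp only [hL]; exact (hc w hw).2 c)
      (fun w hw => (L.analyticAt _).comp (hf.analyticOn w hw)) (fun t => by simp [h0])
      (self_mem_strip z)
    simpa [hL] using this

end StrictContinuation

namespace StrictContinuation

/-! ### Bounded holomorphic functions on a strip -/

/-! Write the extension of `α_t` to `M(A)` through its two actions: on the left `m` becomes `α_t m
γ_{-t}`, on the right `α_t m β_{-t}`. Formally a strict continuation of `m` is thus `α_y m γ_{-y}`
on the left and `α_y m β_{-y}` on the right. A pair `(m, n)` lies in the graph at `z` exactly when
`n γ_z ⊆ α_z m` for the left actions and `n β_z ⊆ α_z m` for the right actions. For fixed `(c, c')`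
in the graph of `γ_z`, the requirement that `(m c, n c')` lie in the graph of `α_z` is strictly
closed in `(m, n)`, because `α_z` is norm closed; likewise for `β_z`. Hence the strict graph is
closed (`isClosed_strictGraph`).

One direction of this characterization is a product of continuations (`apply_mem_analyticGraph`).
The other, `exists_intertwiner_continuation`, builds the orbit `α_y T γ_{-y}` on vectors with entire
`γ`-orbit, which are dense by Gaussian smearing. Its boundary values on `ℝ` and `z + ℝ` are
uniformly bounded operators, so the maximum principle carries the continuation over to all vectors.
Strong analyticity with bounds then gives norm analyticity (`analyticOnNhd_of_forall_apply`).

For the core, let `b_w(e)` be the normalized Gaussian average of `γ_s(e)` centred at `w`, with `e`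
in an approximate unit. Then `γ_z` sends `b_0(e)` to `b_z(e)`. Since `γ_t` is multiplicative and the
Gaussian mass does not change under complex shifts, `b_w(e)` tends strictly to 1 for every complex
`w`. Thus `(m b_0(e), n b_z(e))` lies in the graph of `α_z` and tends strictly to `(m, n)`. Together
with closedness this identifies the strict closure of `α_z`. -/

/-- `h` is bounded and continuous on the strip `S(z)` and analytic on its interior. -/
structure IsStripHolomorphic {E : Type*} [NormedAddCommGroup E] [NormedSpace ℂ E] (z : ℂ)
    (h : ℂ → E) : Prop where
  continuousOn : ContinuousOn h (strip z)
  analyticOn : AnalyticOnNhd ℂ h (interior (strip z))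
  bounded : ∃ C, ∀ y ∈ strip z, ‖h y‖ ≤ C

theorem add_ofReal_mem_strip {z y : ℂ} (hy : y ∈ strip z) (t : ℝ) : y + t ∈ strip z := by
  simpa [strip] using hy

theorem eq_ofReal_of_im_eq_zero {y : ℂ} (hy : y.im = 0) : y = (y.re : ℂ) :=
  Complex.ext (by simp) (by simp [hy])

theorem eq_add_ofReal_of_im_eq {y z : ℂ} (hy : y.im = z.im) : y = z + ((y.re - z.re : ℝ) : ℂ) :=
  Complex.ext (by simp) (by simp [hy])

section StripHolomorphic

variable {E : Type*} [NormedAddCommGroup E] [NormedSpace ℂ E] {z : ℂ} {g h : ℂ → E}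

theorem IsStripHolomorphic.add (hg : IsStripHolomorphic z g) (hh : IsStripHolomorphic z h) :
    IsStripHolomorphic z (fun y => g y + h y) := by
  obtain ⟨C, hC⟩ := hg.bounded
  obtain ⟨D, hD⟩ := hh.bounded
  exact ⟨hg.continuousOn.add hh.continuousOn, hg.analyticOn.add hh.analyticOn, C + D,
    fun y hy => (norm_add_le _ _).trans (add_le_add (hC y hy) (hD y hy))⟩

theorem IsStripHolomorphic.const_smul (hg : IsStripHolomorphic z g) (c : ℂ) :
    IsStripHolomorphic z (fun y => c • g y) := by
  obtain ⟨C, hC⟩ := hg.bounded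
  refine ⟨hg.continuousOn.const_smul c, fun w hw => (hg.analyticOn w hw).const_smul, ‖c‖ * C,
    fun y hy => ?_⟩
  rw [norm_smul]
  exact mul_le_mul_of_nonneg_left (hC y hy) (norm_nonneg _)

theorem IsStripHolomorphic.sub (hg : IsStripHolomorphic z g) (hh : IsStripHolomorphic z h) :
    IsStripHolomorphic z (fun y => g y - h y) := by
  simpa [sub_eq_add_neg] using hg.add (hh.const_smul (-1))

theorem IsStripHolomorphic.eqOn (hg : IsStripHolomorphic z g) (hh : IsStripHolomorphic z h)
    (h0 : ∀ t : ℝ, g t = h t) : Set.EqOn g h (strip z) := fun y hy =>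
  sub_eq_zero.1 (eqOn_zero_strip (hg.sub hh).continuousOn (hg.sub hh).analyticOn
    (fun t => by simp [h0]) hy)

/-- Maximum principle on the strip `S(z)`. -/
theorem IsStripHolomorphic.norm_le (hh : IsStripHolomorphic z h) {C : ℝ}
    (h₀ : ∀ t : ℝ, ‖h t‖ ≤ C) (h₁ : ∀ t : ℝ, ‖h (z + t)‖ ≤ C) {y : ℂ} (hy : y ∈ strip z) :
    ‖h y‖ ≤ C := by
  have b₀ : ∀ w : ℂ, w.im = 0 → ‖h w‖ ≤ C := fun w hw => by
    rw [eq_ofReal_of_im_eq_zero hw]; exact h₀ _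
  have b₁ : ∀ w : ℂ, w.im = z.im → ‖h w‖ ≤ C := fun w hw => by
    rw [eq_add_ofReal_of_im_eq hw]; exact h₁ _
  by_cases hz : z.im = 0
  · refine b₀ y ?_
    simpa [strip, hz] using hy
  have hlt : min 0 z.im < max 0 z.im := min_lt_max.2 (Ne.symm hz)
  have hint := interior_strip z
  refine PhragmenLindelof.horizontal_strip (a := min 0 z.im) (b := max 0 z.im) ⟨?_, ?_⟩ ?_ ?_ ?_
    hy.1 hy.2
  · exact (hint ▸ hh.analyticOn).differentiableOn
  · rw [Complex.closure_preimage_im, closure_Ioo hlt.ne]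
    exact hh.continuousOn
  · obtain ⟨D, hD⟩ := hh.bounded
    -- Boundedness is the case of the Phragmén–Lindelöf growth condition in which both constants are
    -- 0.
    refine ⟨0, div_pos Real.pi_pos (sub_pos.2 hlt), 0, Asymptotics.IsBigO.of_bound D ?_⟩
    filter_upwards [Filter.mem_inf_of_right (Filter.mem_principal_self _)] with w hw
    simpa using hD w ⟨hw.1.le, hw.2.le⟩
  · intro w hw
    rcases min_choice 0 z.im with e | e
    exacts [b₀ w (hw.trans e), b₁ w (hw.trans e)]
  · intro w hw
    rcases max_choice 0 z.im with e | e
    exacts [b₀ w (hw.trans e), b₁ w (hw.trans e)]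

/-- A uniformly Cauchy sequence of bounded holomorphic functions on a strip has a limit. -/
theorem exists_limit_of_uniformCauchySeqOn [CompleteSpace E] {h : ℕ → ℂ → E}
    (hh : ∀ n, IsStripHolomorphic z (h n))
    (hC : UniformCauchySeqOn h Filter.atTop (strip z)) :
    ∃ f : ℂ → E, IsStripHolomorphic z f ∧
      ∀ y ∈ strip z, Filter.Tendsto (fun n => h n y) Filter.atTop (𝓝 (f y)) := by
  have hex : ∀ y, ∃ l, y ∈ strip z → Filter.Tendsto (fun n => h n y) Filter.atTop (𝓝 l) := by
    intro y
    by_cases hy : y ∈ strip z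
    · obtain ⟨l, hl⟩ := cauchySeq_tendsto_of_complete (hC.cauchySeq hy)
      exact ⟨l, fun _ => hl⟩
    · exact ⟨0, fun h => absurd h hy⟩
  choose f hf using hex
  have hu : TendstoUniformlyOn h f Filter.atTop (strip z) := hC.tendstoUniformlyOn_of_tendsto hf
  refine ⟨f, ⟨?_, ?_, ?_⟩, hf⟩
  · exact hu.continuousOn (Filter.Frequently.of_forall fun n => (hh n).continuousOn)
  · rw [Complex.analyticOnNhd_iff_differentiableOn isOpen_interior]
    exact (hu.mono interior_subset).tendstoLocallyUniformlyOn.differentiableOn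
      (.of_forall fun n => (hh n).analyticOn.differentiableOn) isOpen_interior
  · obtain ⟨n, hn⟩ := (Metric.tendstoUniformlyOn_iff.1 hu 1 one_pos).exists
    obtain ⟨D, hD⟩ := (hh n).bounded
    refine ⟨1 + D, fun y hy => ?_⟩
    calc ‖f y‖ = ‖(f y - h n y) + h n y‖ := by simp
      _ ≤ ‖f y - h n y‖ + ‖h n y‖ := norm_add_le _ _
      _ ≤ 1 + D := add_le_add (by rw [← dist_eq_norm]; exact (hn y hy).le) (hD y hy)

end StripHolomorphic

/-! ### Operator-valued analytic functions -/

/-- A locally bounded, strongly analytic operator-valued function is norm analytic. -/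
theorem analyticOnNhd_of_forall_apply {V E : Type*} [NormedAddCommGroup V] [NormedSpace ℂ V]
    [NormedAddCommGroup E] [NormedSpace ℂ E] [CompleteSpace E] {Φ : ℂ → V →L[ℂ] E} {U : Set ℂ}
    (hU : IsOpen U) {C : ℝ} (hC : ∀ y ∈ U, ‖Φ y‖ ≤ C)
    (hΦ : ∀ v, DifferentiableOn ℂ (fun y => Φ y v) U) : AnalyticOnNhd ℂ Φ U := by
  have hcont : ContinuousOn Φ U := by
    intro c hc
    refine ContinuousAt.continuousWithinAt ?_
    obtain ⟨r, hr, hrU⟩ := Metric.isOpen_iff.1 hU c hc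
    have hC0 : 0 ≤ C := (norm_nonneg _).trans (hC c hc)
    -- By the Schwarz lemma each `Φ y v` is Lipschitz near `c`, with a constant proportional to
    -- `‖v‖`; this upgrades strong to norm continuity.
    have hlip : ∀ y ∈ Metric.ball c r, ‖Φ y - Φ c‖ ≤ 2 * C / r * dist y c := by
      intro y hy
      refine ContinuousLinearMap.opNorm_le_bound _ (by positivity) fun v => ?_
      have := Complex.dist_le_div_mul_dist_of_mapsTo_ball (R₂ := 2 * C * ‖v‖)
        ((hΦ v).mono hrU) (fun w hw => ?_) hy
      · rw [dist_eq_norm] at this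
        calc _ ≤ _ := this
          _ = _ := by ring
      · rw [Metric.mem_closedBall, dist_eq_norm, ← sub_apply]
        refine (ContinuousLinearMap.le_opNorm _ _).trans ?_
        gcongr
        refine (norm_sub_le _ _).trans ?_
        linarith [hC w (hrU hw), hC c hc]
    rw [ContinuousAt, tendsto_iff_norm_sub_tendsto_zero]
    refine squeeze_zero' (.of_forall fun _ => norm_nonneg _)
      (Filter.eventually_of_mem (Metric.ball_mem_nhds c hr) hlip) ?_
    have : Continuous fun y : ℂ => 2 * C / r * dist y c := by fun_prop
    simpa using this.tendsto c
  intro c hc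
  obtain ⟨r, hr, hrU⟩ := Metric.nhds_basis_closedBall.mem_iff.1 (hU.mem_nhds hc)
  lift r to NNReal using hr.le
  have hci : CircleIntegrable Φ c r :=
    (hcont.mono (Metric.sphere_subset_closedBall.trans hrU)).circleIntegrable hr.le
  -- The operator-valued Cauchy integral is analytic, and it equals `Φ` by Cauchy's formula on each
  -- vector.
  refine (hasFPowerSeriesOn_cauchy_integral hci hr).analyticAt.congr ?_
  filter_upwards [Metric.ball_mem_nhds c hr] with w hw
  ext v
  have hd : DiffContOnCl ℂ (fun y => Φ y v) (Metric.ball c r) :=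
    ((hΦ v).mono hrU).diffContOnCl_ball subset_rfl
  rw [← hd.two_pi_i_inv_smul_circleIntegral_sub_inv_smul hw, smul_apply]
  congr 1
  have hne : ∀ ζ ∈ Metric.sphere c (r : ℝ), ζ - w ≠ 0 := by
    intro ζ hζ h0
    rw [sub_eq_zero] at h0
    subst h0
    rw [Metric.mem_sphere] at hζ
    rw [Metric.mem_ball] at hw
    exact hw.ne hζ
  have hci' : CircleIntegrable (fun ζ => (ζ - w)⁻¹ • Φ ζ) c r := by
    refine ContinuousOn.circleIntegrable hr.le ?_
    exact (ContinuousOn.inv₀ (by fun_prop) hne).smul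
      (hcont.mono (Metric.sphere_subset_closedBall.trans hrU))
  simp only [circleIntegral]
  rw [ContinuousLinearMap.intervalIntegral_apply]
  · simp
  · exact hci'.out

/-- Differentiability of a function into a complete space can be tested after composing with a
linear isometry. -/
theorem _root_.LinearIsometry.differentiableAt_of_comp {V W : Type*} [NormedAddCommGroup V]
    [NormedSpace ℂ V] [CompleteSpace V] [NormedAddCommGroup W] [NormedSpace ℂ W] (ι : V →ₗᵢ[ℂ] W)
    {f : ℂ → V} {y : ℂ} (hf : DifferentiableAt ℂ (fun w => ι (f w)) y) :
    DifferentiableAt ℂ f y := by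
  have hd := hasDerivAt_iff_tendsto_slope.1 hf.hasDerivAt
  have hs : slope (fun w => ι (f w)) y = fun w => ι (slope f y w) := by
    ext w
    simp [slope_def_module]
  rw [hs] at hd
  obtain ⟨v, hv⟩ : deriv (fun w => ι (f w)) y ∈ Set.range ι :=
    ι.isometry.isClosedEmbedding.isClosed_range.mem_of_tendsto hd (.of_forall fun w => ⟨_, rfl⟩)
  rw [← hv] at hd
  exact (hasDerivAt_iff_tendsto_slope.2
    (ι.isometry.isClosedEmbedding.isInducing.tendsto_nhds_iff.2 hd)).differentiableAt

/-! ### Strip holomorphic functions with prescribed boundary values -/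

section Boundary

variable {V E : Type*} [NormedAddCommGroup V] [NormedSpace ℂ V]
  [NormedAddCommGroup E] [NormedSpace ℂ E]

/-- The vectors `x` for which `t ↦ u_t(x)` and `t ↦ v_t(x)` are the boundary values on `ℝ` and
`z + ℝ` of a bounded holomorphic function on the strip. -/
def boundarySubmodule (z : ℂ) (u v : ℝ → V →L[ℂ] E) : Submodule ℂ V where
  carrier := {x | ∃ h : ℂ → E, IsStripHolomorphic z h ∧ (∀ t : ℝ, h t = u t x) ∧
    ∀ t : ℝ, h (z + t) = v t x}
  zero_mem' := ⟨fun _ => 0, ⟨continuousOn_const, analyticOnNhd_const, 0, by simp⟩, by simp, by simp⟩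
  add_mem' := by
    rintro _ _ ⟨f, hf, hf₀, hf₁⟩ ⟨g, hg, hg₀, hg₁⟩
    exact ⟨_, hf.add hg, fun t => by simp [hf₀, hg₀], fun t => by simp [hf₁, hg₁]⟩
  smul_mem' := by
    rintro c _ ⟨f, hf, hf₀, hf₁⟩
    exact ⟨_, hf.const_smul c, fun t => by simp [hf₀], fun t => by simp [hf₁]⟩

/-- By the maximum principle, extensions belonging to two vectors differ on the whole strip by at
most `K` times the distance of the vectors. Extensions along a convergent sequence are therefore
uniformly Cauchy. -/
theorem isClosed_boundarySubmodule [CompleteSpace E] {z : ℂ} {u v : ℝ → V →L[ℂ] E} {K : ℝ}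
    (hu : ∀ t, ‖u t‖ ≤ K) (hv : ∀ t, ‖v t‖ ≤ K) :
    IsClosed (boundarySubmodule z u v : Set V) := by
  refine IsSeqClosed.isClosed fun x a hx hxa => ?_
  choose h hh h₀ h₁ using hx
  have hC : UniformCauchySeqOn h Filter.atTop (strip z) := by
    rw [Metric.uniformCauchySeqOn_iff]
    intro ε hε
    have hK : 0 ≤ K := (norm_nonneg _).trans (hu 0)
    obtain ⟨N, hN⟩ := Metric.cauchySeq_iff.1 hxa.cauchySeq (ε / (K + 1)) (by positivity)
    refine ⟨N, fun m hm n hn y hy => ?_⟩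
    have hb : ‖h m y - h n y‖ ≤ K * ‖x m - x n‖ := by
      refine ((hh m).sub (hh n)).norm_le (fun t => ?_) (fun t => ?_) hy
      · rw [h₀, h₀, ← map_sub]; exact (u t).le_of_opNorm_le (hu t) _
      · rw [h₁, h₁, ← map_sub]; exact (v t).le_of_opNorm_le (hv t) _
    have hmn := hN m hm n hn
    rw [dist_eq_norm, lt_div_iff₀ (by positivity)] at hmn
    rw [dist_eq_norm]
    nlinarith [norm_nonneg (x m - x n)]
  obtain ⟨f, hf, hlim⟩ := exists_limit_of_uniformCauchySeqOn hh hC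
  refine ⟨f, hf, fun t => ?_, fun t => ?_⟩
  · refine tendsto_nhds_unique (hlim _ (ofReal_mem_strip z t)) ?_
    simp only [h₀]
    exact ((u t).continuous.tendsto a).comp hxa
  · refine tendsto_nhds_unique (hlim _ (add_ofReal_mem_strip (self_mem_strip z) t)) ?_
    simp only [h₁]
    exact ((v t).continuous.tendsto a).comp hxa

/-- Evaluation in the strip is a bounded operator valued function of the boundary data. -/
theorem exists_boundary_evaluation [CompleteSpace E] {z : ℂ} {u v : ℝ → V →L[ℂ] E} {K : ℝ}
    (hu : ∀ t, ‖u t‖ ≤ K) (hv : ∀ t, ‖v t‖ ≤ K) :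
    ∃ Φ : ℂ → boundarySubmodule z u v →L[ℂ] E, (∀ y ∈ strip z, ‖Φ y‖ ≤ K) ∧
      (∀ x, ContinuousOn (fun y => Φ y x) (strip z)) ∧
      AnalyticOnNhd ℂ Φ (interior (strip z)) ∧
      (∀ (t : ℝ) (x), Φ t x = u t x) ∧ ∀ (t : ℝ) (x), Φ (z + t) x = v t x := by
  classical
  choose h hh h₀ h₁ using fun x : boundarySubmodule z u v => x.2
  have hb : ∀ y ∈ strip z, ∀ x, ‖h x y‖ ≤ K * ‖x‖ := fun y hy x =>
    (hh x).norm_le (fun t => by rw [h₀]; exact (u t).le_of_opNorm_le (hu t) _)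
      (fun t => by rw [h₁]; exact (v t).le_of_opNorm_le (hv t) _) hy
  have hex : ∀ y, ∃ T : boundarySubmodule z u v →L[ℂ] E, y ∈ strip z → ‖T‖ ≤ K ∧ ∀ x, T x = h x y := by
    intro y
    by_cases hy : y ∈ strip z
    -- Extensions are determined by their values on `ℝ`, which makes evaluation at `y` linear.
    · refine ⟨LinearMap.mkContinuous
        { toFun := fun x => h x y
          map_add' := fun x x' => (hh _).eqOn ((hh x).add (hh x')) (fun t => by simp [h₀]) hy
          map_smul' := fun c x => (hh _).eqOn ((hh x).const_smul c) (fun t => by simp [h₀]) hy } K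
        (hb y hy), fun _ => ⟨?_, fun x => rfl⟩⟩
      exact LinearMap.mkContinuous_norm_le _ ((norm_nonneg _).trans (hu 0)) _
    · exact ⟨0, fun h => absurd h hy⟩
  choose Φ hΦ using hex
  have hcongr : ∀ x, Set.EqOn (fun y => Φ y x) (h x) (strip z) := fun x y hy => (hΦ y hy).2 x
  refine ⟨Φ, fun y hy => (hΦ y hy).1, fun x => (hh x).continuousOn.congr (hcongr x), ?_, ?_, ?_⟩
  · exact analyticOnNhd_of_forall_apply isOpen_interior
      (fun y hy => (hΦ y (interior_subset hy)).1) fun x =>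
      (hh x).analyticOn.differentiableOn.congr fun y hy => hcongr x (interior_subset hy)
  · exact fun t x => (hcongr x (ofReal_mem_strip z t)).trans (h₀ x t)
  · exact fun t x => (hcongr x (add_ofReal_mem_strip (self_mem_strip z) t)).trans (h₁ x t)

end Boundary

/-! ### The graph of the analytic continuation -/

theorem norm_comp_le_of_norm_le_one {V E F : Type*} [NormedAddCommGroup V] [NormedSpace ℂ V]
    [NormedAddCommGroup E] [NormedSpace ℂ E] [NormedAddCommGroup F] [NormedSpace ℂ F]
    {f : E →L[ℂ] F} {g : V →L[ℂ] E} {K : ℝ} (hf : ‖f‖ ≤ 1) (hg : ‖g‖ ≤ K) : ‖f.comp g‖ ≤ K := by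
  refine (f.opNorm_comp_le g).trans ?_
  nlinarith [norm_nonneg g, norm_nonneg f]

/-- Uniformly bounded, strongly convergent operators may be applied to convergent vectors. -/
theorem tendsto_apply_of_eventually_norm_le {ι V E : Type*} [NormedAddCommGroup V]
    [NormedSpace ℂ V] [NormedAddCommGroup E] [NormedSpace ℂ E] {l : Filter ι} {Φ : ι → V →L[ℂ] E}
    {P : ι → V} {p : V} {q : E} {C : ℝ} (hC : ∀ᶠ y in l, ‖Φ y‖ ≤ C)
    (hΦ : Filter.Tendsto (fun y => Φ y p) l (𝓝 q)) (hP : Filter.Tendsto P l (𝓝 p)) :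
    Filter.Tendsto (fun y => Φ y (P y)) l (𝓝 q) := by
  have h : Filter.Tendsto (fun y => Φ y (P y - p)) l (𝓝 0) := by
    refine squeeze_zero_norm' (a := fun y => C * ‖P y - p‖) ?_ ?_
    · filter_upwards [hC] with y hy using (Φ y).le_of_opNorm_le hy _
    · simpa using (tendsto_iff_norm_sub_tendsto_zero.1 hP).const_mul C
  simpa using h.add hΦ

section Reps

variable {E : Type*} [NormedAddCommGroup E] [NormedSpace ℂ E] {α : OneParamRep E} {z : ℂ}

theorem OneParamRep.add_apply (α : OneParamRep E) (s t : ℝ) (a : E) :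
    α (s + t) a = α s (α t a) := by rw [α.map_add]; rfl

theorem OneParamRep.zero_apply (α : OneParamRep E) (a : E) : α 0 a = a := by rw [α.map_zero]; rfl

theorem OneParamRep.norm_apply_le (α : OneParamRep E) (t : ℝ) (a : E) : ‖α t a‖ ≤ ‖a‖ := by
  simpa using (α t).le_of_opNorm_le (α.norm_le_one t) a

theorem OneParamRep.neg_apply_apply (α : OneParamRep E) (t : ℝ) (a : E) : α (-t) (α t a) = a := by
  simpa using α.apply_neg_apply (-t) a

/-- A function on a strip that is covariant under real translations is bounded. -/
theorem exists_norm_le_of_covariant {h : ℂ → E} {a b : ℝ}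
    (hc : ContinuousOn h {y | y.im ∈ Set.Icc a b})
    (hα : ∀ y : ℂ, y.im ∈ Set.Icc a b → ∀ t : ℝ, h (y + t) = α t (h y)) :
    ∃ C, ∀ y : ℂ, y.im ∈ Set.Icc a b → ‖h y‖ ≤ C := by
  -- Covariance moves every point to a compact vertical segment, and contractions do not increase
  -- the norm.
  have hk : ContinuousOn (fun s : ℝ => h (s * Complex.I)) (Set.Icc a b) :=
    hc.comp (by fun_prop) fun s hs => by simpa using hs
  obtain ⟨C, hC⟩ := isCompact_Icc.exists_bound_of_continuousOn hk
  refine ⟨C, fun y hy => ?_⟩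
  have e : y = y.im * Complex.I + (y.re : ℝ) := by
    rw [add_comm]; exact (Complex.re_add_im y).symm
  rw [e, hα _ (by simpa using hy)]
  exact (α.norm_apply_le _ _).trans (hC _ hy)

/-- On `ℝ` this is the group law; uniqueness of continuation carries it to the strip. -/
theorem IsContinuation.apply_add {a : E} {f : ℂ → E} (hf : IsContinuation α z a f) {y : ℂ}
    (hy : y ∈ strip z) (t : ℝ) : f (y + t) = α t (f y) := by
  have hmaps : Set.MapsTo (fun w : ℂ => w + t) (strip z) (strip z) :=
    fun w hw => add_ofReal_mem_strip hw t
  have hmaps' : Set.MapsTo (fun w : ℂ => w + t) (interior (strip z)) (interior (strip z)) := by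
    intro w hw
    rw [interior_strip] at hw ⊢
    simpa using hw
  have := eqOn_zero_strip (f := fun w => f (w + t) - α t (f w)) (z := z)
    ((hf.continuousOn.comp (by fun_prop) hmaps).sub
      ((α t).continuous.comp_continuousOn hf.continuousOn))
    (fun w hw => ((hf.analyticOn _ (hmaps' hw)).fun_comp (f := fun w : ℂ => w + t)
      (by fun_prop)).sub (((α t).analyticAt _).comp (hf.analyticOn w hw)))
    (fun s => by
      rw [← Complex.ofReal_add, ← hf.eq_real, ← hf.eq_real, add_comm, α.add_apply, sub_self]) hy
  exact sub_eq_zero.1 this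

theorem IsContinuation.isStripHolomorphic {a : E} {f : ℂ → E} (hf : IsContinuation α z a f) :
    IsStripHolomorphic z f :=
  ⟨hf.continuousOn, hf.analyticOn,
    exists_norm_le_of_covariant (α := α) hf.continuousOn fun _ hy t => hf.apply_add hy t⟩

/-- Covariance makes a continuation bounded and turns its value at `z` into its values on all of `z
+ ℝ`, so the graph is described by boundary values alone. -/
theorem analyticGraph_eq_boundarySubmodule (α : OneParamRep E) (z : ℂ) :
    analyticGraph α z = boundarySubmodule z
      (fun t => (α t).comp (ContinuousLinearMap.fst ℂ E E))
      (fun t => (α t).comp (ContinuousLinearMap.snd ℂ E E)) := by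
  ext p
  constructor
  · rintro ⟨f, hf, hfz⟩
    exact ⟨f, hf.isStripHolomorphic, fun t => (hf.eq_real t).symm,
      fun t => by simp [hf.apply_add (self_mem_strip z), hfz]⟩
  · rintro ⟨h, hh, h₀, h₁⟩
    exact ⟨h, ⟨hh.continuousOn, hh.analyticOn, fun t => (h₀ t).symm⟩,
      by simpa [α.zero_apply] using h₁ 0⟩

theorem norm_comp_fst_le_one (α : OneParamRep E) (t : ℝ) :
    ‖(α t).comp (ContinuousLinearMap.fst ℂ E E)‖ ≤ 1 :=
  norm_comp_le_of_norm_le_one (α.norm_le_one t) (ContinuousLinearMap.norm_fst_le ℂ E E)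

theorem norm_comp_snd_le_one (α : OneParamRep E) (t : ℝ) :
    ‖(α t).comp (ContinuousLinearMap.snd ℂ E E)‖ ≤ 1 :=
  norm_comp_le_of_norm_le_one (α.norm_le_one t) (ContinuousLinearMap.norm_snd_le ℂ E E)

/-- The operator `α_z` is norm closed. -/
theorem isClosed_analyticGraph [CompleteSpace E] (α : OneParamRep E) (z : ℂ) :
    IsClosed (analyticGraph α z : Set (E × E)) := by
  rw [analyticGraph_eq_boundarySubmodule]
  exact isClosed_boundarySubmodule (norm_comp_fst_le_one α) (norm_comp_snd_le_one α)

/-! ### Entire orbits and Gaussian smearing -/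

/-- `g` is an entire function that extends the orbit of `g 0`. -/
structure IsEntireOrbit (α : OneParamRep E) (g : ℂ → E) : Prop where
  differentiable : Differentiable ℂ g
  apply_add : ∀ (w : ℂ) (t : ℝ), g (w + t) = α t (g w)

theorem IsEntireOrbit.mem_analyticGraph [CompleteSpace E] {g : ℂ → E} (hg : IsEntireOrbit α g)
    (w z : ℂ) : (g w, g (w + z)) ∈ analyticGraph α z := by
  have hd : Differentiable ℂ fun y => g (w + y) := hg.differentiable.comp (by fun_prop)
  exact ⟨fun y => g (w + y), ⟨hd.continuous.continuousOn, fun y _ => hd.analyticAt y,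
    fun t => (hg.apply_add w t).symm⟩, rfl⟩

theorem IsEntireOrbit.exists_norm_le {g : ℂ → E} (hg : IsEntireOrbit α g) (R : ℝ) :
    ∃ C, ∀ w : ℂ, |w.im| ≤ R → ‖g w‖ ≤ C := by
  obtain ⟨C, hC⟩ := exists_norm_le_of_covariant (α := α) (h := g) (a := -R) (b := R)
    hg.differentiable.continuous.continuousOn fun y _ t => hg.apply_add y t
  exact ⟨C, fun w hw => hC w (abs_le.1 hw)⟩

theorem integrable_gaussian (w : ℂ) :
    MeasureTheory.Integrable fun s : ℝ => Complex.exp (-((s : ℂ) - w) ^ 2) := by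
  convert integrable_cexp_quadratic' (b := -1) (by simp) (2 * w) (-w ^ 2) using 3
  ring

/-- The mass of the Gaussian kernel, which is invariant under complex translations. -/
noncomputable def gaussianMass : ℂ := (Real.pi : ℂ) ^ (1 / 2 : ℂ)

theorem gaussianMass_ne_zero : gaussianMass ≠ 0 := by
  simp [gaussianMass, Complex.cpow_eq_zero_iff, Real.pi_ne_zero]

theorem integral_gaussian_shift (w : ℂ) :
    ∫ s : ℝ, Complex.exp (-((s : ℂ) - w) ^ 2) = gaussianMass := by
  have := integral_cexp_quadratic (b := -1) (by simp) (2 * w) (-w ^ 2)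
  rw [gaussianMass]
  convert this using 1
  · congr 1; ext s; congr 1; ring
  · have : -w ^ 2 - (2 * w) ^ 2 / (4 * -1) = 0 := by ring
    rw [this]; simp

/-- The Gaussian average `∫ exp(-(s - w)²) α_s(x) ds`. -/
noncomputable def gaussianSmear (α : OneParamRep E) (x : E) (w : ℂ) : E :=
  ∫ s : ℝ, Complex.exp (-((s : ℂ) - w) ^ 2) • α s x

theorem integrable_gaussian_smul {φ : ℝ → E} (hφ : Continuous φ) {C : ℝ} (hC : ∀ s, ‖φ s‖ ≤ C)
    (w : ℂ) : MeasureTheory.Integrable fun s : ℝ => Complex.exp (-((s : ℂ) - w) ^ 2) • φ s := by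
  refine ((integrable_gaussian w).norm.mul_const C).mono'
    (by fun_prop) (.of_forall fun s => ?_)
  rw [norm_smul]
  exact mul_le_mul_of_nonneg_left (hC s) (norm_nonneg _)

/-- A majorant, integrable in `s` and uniform in `w`, for differentiating the Gaussian average under
the integral sign. -/
theorem norm_gaussian_deriv_le {w₀ w : ℂ} (hw : w ∈ Metric.ball w₀ 1) (s : ℝ) :
    ‖2 * ((s : ℂ) - w) * Complex.exp (-((s : ℂ) - w) ^ 2)‖ ≤
      2 * Real.exp (1 + (|w₀.im| + 1) ^ 2) *
        (‖(s - w₀.re) * Real.exp (-(1 / 2) * (s - w₀.re) ^ 2)‖ +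
          (|w₀.im| + 1) * Real.exp (-(1 / 2) * (s - w₀.re) ^ 2)) := by
  have hw' : ‖w - w₀‖ ≤ 1 := by rw [← dist_eq_norm]; exact (Metric.mem_ball.1 hw).le
  have hre : |w.re - w₀.re| ≤ 1 := by simpa using (Complex.abs_re_le_norm (w - w₀)).trans hw'
  have him : |w.im - w₀.im| ≤ 1 := by simpa using (Complex.abs_im_le_norm (w - w₀)).trans hw'
  have hexp : ‖Complex.exp (-((s : ℂ) - w) ^ 2)‖ ≤
      Real.exp (1 + (|w₀.im| + 1) ^ 2) * Real.exp (-(1 / 2) * (s - w₀.re) ^ 2) := by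
    rw [Complex.norm_exp, ← Real.exp_add, Real.exp_le_exp]
    have e : (-((s : ℂ) - w) ^ 2).re = -(s - w.re) ^ 2 + w.im ^ 2 := by
      simp [pow_two]; ring
    rw [e]
    have h1 : w.im ^ 2 ≤ (|w₀.im| + 1) ^ 2 := by
      rw [← sq_abs w.im]
      have : |w.im| ≤ |w₀.im| + 1 := by
        have := abs_sub_abs_le_abs_sub w.im w₀.im; linarith
      gcongr
    have h2 : (w.re - w₀.re) ^ 2 ≤ 1 := (sq_le_one_iff_abs_le_one _).2 hre
    -- From `(a + b)² ≤ 2a² + 2b²`: moving the centre by at most 1 costs half the decay rate and a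
    -- factor `e`.
    nlinarith [sq_nonneg (s - w.re - (w.re - w₀.re))]
  have hlin : ‖(s : ℂ) - w‖ ≤ |s - w₀.re| + (|w₀.im| + 1) := by
    have h1 : ‖(s : ℂ) - w₀‖ ≤ |s - w₀.re| + |w₀.im| := by
      simpa using Complex.norm_le_abs_re_add_abs_im ((s : ℂ) - w₀)
    have h2 := norm_sub_le_norm_sub_add_norm_sub (s : ℂ) w₀ w
    rw [norm_sub_rev w₀ w] at h2
    linarith
  rw [norm_mul, norm_mul, norm_mul, Real.norm_eq_abs, Real.norm_eq_abs, Real.abs_exp,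
    Complex.norm_two]
  calc _ ≤ 2 * (|s - w₀.re| + (|w₀.im| + 1)) * (Real.exp (1 + (|w₀.im| + 1) ^ 2) *
        Real.exp (-(1 / 2) * (s - w₀.re) ^ 2)) := by gcongr
    _ = _ := by ring

theorem differentiable_gaussianSmear (hα : α.StronglyContinuous) (x : E) :
    Differentiable ℂ (gaussianSmear α x) := by
  intro w₀
  have hint : MeasureTheory.Integrable fun s : ℝ => 2 * Real.exp (1 + (|w₀.im| + 1) ^ 2) *
        (‖(s - w₀.re) * Real.exp (-(1 / 2) * (s - w₀.re) ^ 2)‖ +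
          (|w₀.im| + 1) * Real.exp (-(1 / 2) * (s - w₀.re) ^ 2)) := by
    have h1 := (integrable_mul_exp_neg_mul_sq (b := 1 / 2) (by norm_num)).comp_sub_right w₀.re
    have h2 := (integrable_exp_neg_mul_sq (b := 1 / 2) (by norm_num)).comp_sub_right w₀.re
    exact (h1.norm.add (h2.const_mul _)).const_mul _
  refine (hasDerivAt_integral_of_dominated_loc_of_deriv_le (Metric.ball_mem_nhds w₀ one_pos)
    (F' := fun w s => (2 * ((s : ℂ) - w) * Complex.exp (-((s : ℂ) - w) ^ 2)) • α s x)
    (.of_forall fun w => (integrable_gaussian_smul (hα x) (fun s => α.norm_apply_le s x)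
      w).aestronglyMeasurable)
    (integrable_gaussian_smul (hα x) (fun s => α.norm_apply_le s x) w₀) ?_
    (.of_forall fun s w hw => ?_) (hint.mul_const ‖x‖)
    (.of_forall fun s w _ => ?_)).2.differentiableAt
  · have := hα x
    exact Continuous.aestronglyMeasurable (by fun_prop)
  · rw [norm_smul]
    exact mul_le_mul (norm_gaussian_deriv_le hw s) (α.norm_apply_le s x) (norm_nonneg _)
      ((norm_nonneg _).trans (norm_gaussian_deriv_le hw s))
  · refine HasDerivAt.smul_const ?_ (α s x)
    have h1 : HasDerivAt (fun w : ℂ => -((s : ℂ) - w) ^ 2) (2 * ((s : ℂ) - w)) w := by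
      have := (((hasDerivAt_id' w).const_sub (s : ℂ)).fun_pow 2).fun_neg
      simpa using this
    have h2 := h1.cexp
    rwa [mul_comm] at h2

/-- The kernel depends only on `s - w`, so shifting `w` by `t` amounts to translating the
integration variable. -/
theorem isEntireOrbit_gaussianSmear [CompleteSpace E] (hα : α.StronglyContinuous) (x : E) :
    IsEntireOrbit α (gaussianSmear α x) := by
  refine ⟨differentiable_gaussianSmear hα x, fun w t => ?_⟩
  rw [gaussianSmear, gaussianSmear, ← ContinuousLinearMap.integral_comp_comm _
    (integrable_gaussian_smul (hα x) (fun s => α.norm_apply_le s x) w),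
    ← MeasureTheory.integral_add_right_eq_self _ t]
  congr 1
  ext s
  rw [map_smul, add_comm s t, α.add_apply]
  congr 3
  push_cast
  ring

/-- The representation `t ↦ α_{rt}`. -/
def OneParamRep.rescale (α : OneParamRep E) (r : ℝ) : OneParamRep E where
  toFun t := α (r * t)
  map_add s t := by rw [mul_add, α.map_add]
  map_zero := by rw [mul_zero, α.map_zero]
  norm_le_one t := α.norm_le_one _

theorem OneParamRep.StronglyContinuous.rescale (hα : α.StronglyContinuous) (r : ℝ) :
    (α.rescale r).StronglyContinuous := fun a => (hα a).comp (continuous_const_mul r)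

theorem IsEntireOrbit.of_rescale {r : ℝ} (hr : r ≠ 0) {g : ℂ → E}
    (hg : IsEntireOrbit (α.rescale r) g) : IsEntireOrbit α fun w => g (w / r) := by
  refine ⟨hg.differentiable.comp (by fun_prop), fun w t => ?_⟩
  have := hg.apply_add (w / r) (t / r)
  rw [add_div, ← Complex.ofReal_div, this]
  change α (r * (t / r)) _ = _
  rw [mul_div_cancel₀ _ hr]

theorem IsEntireOrbit.const_smul {g : ℂ → E} (hg : IsEntireOrbit α g) (c : ℂ) :
    IsEntireOrbit α fun w => c • g w :=
  ⟨hg.differentiable.const_smul c, fun w t => by rw [hg.apply_add, map_smul]⟩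

/-- Vectors with an entire orbit are dense. -/
theorem dense_entireOrbit [CompleteSpace E] (hα : α.StronglyContinuous) :
    Dense {d : E | ∃ g, IsEntireOrbit α g ∧ g 0 = d} := by
  intro x
  -- Slowing the group down by `1 / (n + 1)` has the effect of concentrating the kernel at 0.
  refine mem_closure_of_tendsto (b := Filter.atTop)
    (f := fun n : ℕ => gaussianMass⁻¹ • gaussianSmear (α.rescale (1 / ((n : ℝ) + 1))) x 0) ?_
    (.of_forall fun n => ⟨_, ((isEntireOrbit_gaussianSmear
      (hα.rescale (1 / ((n : ℝ) + 1))) x).of_rescale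
      (by positivity)).const_smul gaussianMass⁻¹, by simp⟩)
  have hlim : Filter.Tendsto
      (fun n : ℕ => gaussianSmear (α.rescale (1 / ((n : ℝ) + 1))) x 0) Filter.atTop
      (𝓝 (∫ s : ℝ, Complex.exp (-((s : ℂ) - 0) ^ 2) • x)) := by
    refine MeasureTheory.tendsto_integral_of_dominated_convergence
      (fun s => ‖Complex.exp (-((s : ℂ) - 0) ^ 2)‖ * ‖x‖)
      (fun n => (integrable_gaussian_smul (hα.rescale _ x)
        (fun s => OneParamRep.norm_apply_le _ s x) 0).aestronglyMeasurable)
      ((integrable_gaussian 0).norm.mul_const _)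
      (fun n => .of_forall fun s => ?_) (.of_forall fun s => ?_)
    · rw [norm_smul]
      exact mul_le_mul_of_nonneg_left (OneParamRep.norm_apply_le _ s x) (norm_nonneg _)
    · refine Filter.Tendsto.const_smul ?_ _
      have h1 : Filter.Tendsto (fun n : ℕ => 1 / ((n : ℝ) + 1) * s) Filter.atTop (𝓝 0) := by
        simpa using (tendsto_one_div_add_atTop_nhds_zero_nat (𝕜 := ℝ)).mul_const s
      have h2 := ((hα x).tendsto 0).comp h1
      rw [α.zero_apply] at h2
      exact h2
  rw [integral_smul_const, integral_gaussian_shift] at hlim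
  simpa [smul_smul, gaussianMass_ne_zero] using hlim.const_smul gaussianMass⁻¹

end Reps

/-! ### Intertwining operators -/

/-- If `T` and `S` intertwine `γ_z` and `α_z`, in the sense that `S γ_z ⊆ α_z T`, then the orbit
`t ↦ α_t T γ_{-t}` has a continuation to the strip with value `S` at `z`. -/
theorem exists_intertwiner_continuation {X Y : Type*} [NormedAddCommGroup X] [NormedSpace ℂ X]
    [CompleteSpace X] [NormedAddCommGroup Y] [NormedSpace ℂ Y] [CompleteSpace Y]
    {γ : OneParamRep X} (hγ : γ.StronglyContinuous) (α : OneParamRep Y) {z : ℂ} {T S : X →L[ℂ] Y}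
    (hTS : ∀ c c', (c, c') ∈ analyticGraph γ z → (T c, S c') ∈ analyticGraph α z) :
    ∃ L : ℂ → X →L[ℂ] Y, (∀ x, ContinuousOn (fun y => L y x) (strip z)) ∧
      AnalyticOnNhd ℂ L (interior (strip z)) ∧ (∀ (t : ℝ) (x), L t x = α t (T (γ (-t) x))) ∧
      L z = S := by
  set u : ℝ → X →L[ℂ] Y := fun t => (α t).comp (T.comp (γ (-t))) with hu
  -- Formally `α_{z+t} T γ_{-z-t} = α_t S γ_{-t}`, since `α_z T γ_{-z} = S`.
  set v : ℝ → X →L[ℂ] Y := fun t => (α t).comp (S.comp (γ (-t))) with hv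
  have aux : ∀ (R : X →L[ℂ] Y) (t : ℝ), ‖(α t).comp (R.comp (γ (-t)))‖ ≤ ‖R‖ := fun R t =>
    norm_comp_le_of_norm_le_one (α.norm_le_one t) ((R.opNorm_comp_le _).trans
      (mul_le_of_le_one_right (norm_nonneg _) (γ.norm_le_one _)))
  have huK : ∀ t, ‖u t‖ ≤ max ‖T‖ ‖S‖ := fun t => (aux T t).trans (le_max_left _ _)
  have hvK : ∀ t, ‖v t‖ ≤ max ‖T‖ ‖S‖ := fun t => (aux S t).trans (le_max_right _ _)
  have htop : boundarySubmodule z u v = ⊤ := by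
    rw [eq_top_iff]
    intro x _
    refine (isClosed_boundarySubmodule huK hvK).closure_subset_iff.2 ?_ (dense_entireOrbit hγ x)
    rintro _ ⟨g, hg, rfl⟩
    have hG := analyticGraph_eq_boundarySubmodule α z
    obtain ⟨Φ, hΦ₁, hΦc, hΦa, hΦ₀, hΦz⟩ :=
      exists_boundary_evaluation (z := z) (norm_comp_fst_le_one α) (norm_comp_snd_le_one α)
    -- The hypothesis is applied to `g (-y)`, which `γ_z` sends to `g (-y + z)`.
    have hmem : ∀ y, (T (g (-y)), S (g (-y + z))) ∈ boundarySubmodule z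
        (fun t => (α t).comp (ContinuousLinearMap.fst ℂ Y Y))
        (fun t => (α t).comp (ContinuousLinearMap.snd ℂ Y Y)) := fun y => by
      rw [← hG]; exact hTS _ _ (hg.mem_analyticGraph _ _)
    have : CompleteSpace (boundarySubmodule z
        (fun t => (α t).comp (ContinuousLinearMap.fst ℂ Y Y))
        (fun t => (α t).comp (ContinuousLinearMap.snd ℂ Y Y))) := by
      rw [← hG]; exact (isClosed_analyticGraph α z).completeSpace_coe
    set P := fun y => (⟨_, hmem y⟩ : boundarySubmodule z
        (fun t => (α t).comp (ContinuousLinearMap.fst ℂ Y Y))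
        (fun t => (α t).comp (ContinuousLinearMap.snd ℂ Y Y))) with hP
    have hPd : Differentiable ℂ P := by
      intro y
      refine (Submodule.subtypeₗᵢ _).differentiableAt_of_comp ?_
      have := hg.differentiable
      change DifferentiableAt ℂ (fun y => (T (g (-y)), S (g (-y + z)))) y
      fun_prop
    -- `Φ y` applies `α_y` to the first component, so this is `α_y T γ_{-y}` at the vector `g 0`. At
    -- `y = z + t` it equals `α_t` of the second component, which is `S (g (-t))`.
    refine ⟨fun y => Φ y (P y), ⟨?_, ?_, ?_⟩, ?_, ?_⟩
    · intro y hy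
      exact tendsto_apply_of_eventually_norm_le
        (Filter.eventually_of_mem self_mem_nhdsWithin hΦ₁) (hΦc (P y) y hy)
        (hPd.continuous.continuousWithinAt)
    · rw [Complex.analyticOnNhd_iff_differentiableOn isOpen_interior]
      exact hΦa.differentiableOn.clm_apply hPd.differentiableOn
    · obtain ⟨C, hC⟩ := hg.exists_norm_le (|z.im| + |z.im|)
      refine ⟨max (‖T‖ * C) (‖S‖ * C), fun y hy => ?_⟩
      have hy' : |y.im| ≤ |z.im| := by
        have h := Set.abs_sub_left_of_mem_uIcc (a := (0:ℝ)) (b := z.im) (c := y.im) hy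
        simpa using h
      refine ((Φ y).le_of_opNorm_le (hΦ₁ y hy) _).trans ?_
      rw [one_mul]
      refine max_le_max (T.le_opNorm_of_le (hC _ ?_)) (S.le_opNorm_of_le (hC _ ?_))
      · simp only [Complex.neg_im, abs_neg]; linarith [abs_nonneg z.im]
      · rw [Complex.add_im, Complex.neg_im]
        refine (abs_add_le _ _).trans ?_
        rw [abs_neg]; linarith
    · intro t
      have h0 := hg.apply_add 0 (-t)
      simp only [Complex.ofReal_neg, zero_add] at h0
      simp [hΦ₀, hP, hu, h0]
    · intro t
      have h0 := hg.apply_add 0 (-t)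
      simp only [Complex.ofReal_neg, zero_add] at h0
      simp [hΦz, hP, hv, h0]
  obtain ⟨Φ, hΦ₁, hΦc, hΦa, hΦ₀, hΦz⟩ := exists_boundary_evaluation (z := z) huK hvK
  let ι : X →L[ℂ] boundarySubmodule z u v :=
    (ContinuousLinearMap.id ℂ X).codRestrict _ fun x => by rw [htop]; trivial
  refine ⟨fun y => (Φ y).comp ι, fun x => hΦc (ι x), ?_, fun t x => hΦ₀ t (ι x), ?_⟩
  · rw [Complex.analyticOnNhd_iff_differentiableOn isOpen_interior] at hΦa ⊢
    exact hΦa.clm_comp (differentiableOn_const _)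
  · ext x
    have := hΦz 0 (ι x)
    simp only [Complex.ofReal_zero, add_zero] at this
    simp [this, hv, ι, γ.zero_apply, α.zero_apply]

/-- If the orbit `t ↦ α_t T δ_{-t}` has a strongly continuous continuation `L` to the strip, then
`L_z δ_z ⊆ α_z T`. -/
theorem apply_mem_analyticGraph {X Y : Type*} [NormedAddCommGroup X] [NormedSpace ℂ X]
    [CompleteSpace X] [NormedAddCommGroup Y] [NormedSpace ℂ Y] [CompleteSpace Y] {δ : OneParamRep X}
    {α : OneParamRep Y} {z : ℂ} {T : X →L[ℂ] Y} {L : ℂ → X →L[ℂ] Y}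
    (hc : ∀ x, ContinuousOn (fun y => L y x) (strip z))
    (ha : AnalyticOnNhd ℂ L (interior (strip z)))
    (hr : ∀ (t : ℝ) (x), L t x = α t (T (δ (-t) x))) {c c' : X}
    (hcc : (c, c') ∈ analyticGraph δ z) : (T c, L z c') ∈ analyticGraph α z := by
  obtain ⟨g, hg, hgz⟩ := hcc
  simp only at hg hgz
  subst hgz
  -- Formally `α_y T δ_{-y}` applied to `δ_y c`; on `ℝ` the two factors of `δ` cancel.
  refine ⟨fun y => L y (g y), ⟨fun y hy => ?_, ?_, fun t => ?_⟩, rfl⟩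
  · have hK : IsCompact (strip z ∩ Metric.closedBall y 1) :=
      (isCompact_closedBall y 1).inter_left
        (isClosed_Icc.preimage Complex.continuous_im)
    -- On the boundary `L` is only strongly continuous; a local norm bound is what continuity of the
    -- product needs.
    obtain ⟨C, hC⟩ := banach_steinhaus
      (g := fun w : (strip z ∩ Metric.closedBall y 1 : Set ℂ) => L w) fun x => by
        obtain ⟨C, hC⟩ := hK.exists_bound_of_continuousOn ((hc x).mono Set.inter_subset_left)
        exact ⟨C, fun w => hC w w.2⟩
    refine tendsto_apply_of_eventually_norm_le (C := C) ?_ (hc (g y) y hy) (hg.continuousOn y hy)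
    filter_upwards [self_mem_nhdsWithin,
      mem_nhdsWithin_of_mem_nhds (Metric.closedBall_mem_nhds y one_pos)] with w h1 h2
    exact hC ⟨w, h1, h2⟩
  · rw [Complex.analyticOnNhd_iff_differentiableOn isOpen_interior]
    exact ha.differentiableOn.clm_apply hg.analyticOn.differentiableOn
  · rw [hr, ← hg.eq_real, δ.neg_apply_apply]

/-! ### Averages of operators that tend strongly to zero -/

section Averages

variable {ι X : Type*} [NormedAddCommGroup X] [NormedSpace ℂ X] {l : Filter ι}

/-- A norm bound makes strong convergence locally uniform along a continuous curve, and compactness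
makes it uniform. -/
theorem eventually_forall_norm_apply_le {D : ι → X →L[ℂ] X} {C : ℝ}
    (hC : ∀ᶠ i in l, ‖D i‖ ≤ C) (hD : ∀ x, Filter.Tendsto (fun i => D i x) l (𝓝 0))
    {φ : ℝ → X} (hφ : Continuous φ) {K : Set ℝ} (hK : IsCompact K) {ε : ℝ} (hε : 0 < ε) :
    ∀ᶠ i in l, ∀ s ∈ K, ‖D i (φ s)‖ ≤ ε := by
  refine hK.induction_on (p := fun S => ∀ᶠ i in l, ∀ s ∈ S, ‖D i (φ s)‖ ≤ ε) (by simp)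
    (fun S S' hS h => h.mono fun i hi s hs => hi s (hS hs))
    (fun S S' h h' => ?_) fun s _ => ?_
  · filter_upwards [h, h'] with i hi hi' s hs
    exact hs.elim (hi s) (hi' s)
  · have h : Filter.Tendsto (fun q : ι × ℝ => D q.1 (φ q.2)) (l ×ˢ 𝓝 s) (𝓝 0) :=
      tendsto_apply_of_eventually_norm_le (Φ := fun q : ι × ℝ => D q.1) (p := φ s)
        (Filter.tendsto_fst.eventually hC) ((hD _).comp Filter.tendsto_fst)
        ((hφ.tendsto s).comp Filter.tendsto_snd)
    obtain ⟨p, hp, S, hS, hpS⟩ := Filter.eventually_prod_iff.1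
      (h.norm.eventually (Iio_mem_nhds (by simpa using hε)))
    exact ⟨{s | S s}, mem_nhdsWithin_of_mem_nhds hS, hp.mono fun i hi s hs => (hpS hi hs).le⟩

/-- The filter is arbitrary, since approximate units are nets, and dominated convergence can fail
along nets. Instead the kernel is approximated in `L¹` by one of compact support, where convergence
is uniform. -/
theorem tendsto_integral_mul_norm_apply {D : ι → X →L[ℂ] X} {C : ℝ}
    (hC : ∀ᶠ i in l, ‖D i‖ ≤ C) (hD : ∀ x, Filter.Tendsto (fun i => D i x) l (𝓝 0))
    {φ : ℝ → X} (hφ : Continuous φ) {M : ℝ} (hM : ∀ s, ‖φ s‖ ≤ M) {k : ℝ → ℂ}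
    (hk : MeasureTheory.Integrable k) :
    Filter.Tendsto (fun i => ∫ s, ‖k s‖ * ‖D i (φ s)‖) l (𝓝 0) := by
  rcases l.eq_or_neBot with rfl | hl
  · exact Filter.tendsto_bot
  have hM0 : 0 ≤ M := (norm_nonneg _).trans (hM 0)
  have hC0 : 0 ≤ C := by
    obtain ⟨i, hi⟩ := hC.exists
    exact (norm_nonneg _).trans hi
  rw [Metric.tendsto_nhds]
  intro ε hε
  -- The tolerances make both error terms at most `ε / 4`; the added 1 guards against a zero
  -- denominator.
  obtain ⟨g, hgs, hg, hgc, hgi⟩ := hk.exists_hasCompactSupport_integral_sub_le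
    (ε := ε / (4 * (C * M + 1))) (by positivity)
  set I := ∫ s, ‖g s‖ with hI
  have hI0 : 0 ≤ I := MeasureTheory.integral_nonneg fun s => norm_nonneg _
  filter_upwards [hC, eventually_forall_norm_apply_le hC hD hφ hgs.isCompact
    (ε := ε / (4 * (I + 1))) (by positivity)] with i hi hi'
  have hb : ∀ s, ‖k s‖ * ‖D i (φ s)‖ ≤
      ‖k s - g s‖ * (C * M) + ‖g s‖ * (ε / (4 * (I + 1))) := by
    intro s
    have h1 : ‖D i (φ s)‖ ≤ C * M :=
      ((D i).le_of_opNorm_le hi _).trans (mul_le_mul_of_nonneg_left (hM s) hC0)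
    have h2 : ‖g s‖ * ‖D i (φ s)‖ ≤ ‖g s‖ * (ε / (4 * (I + 1))) := by
      by_cases hs : s ∈ tsupport g
      · exact mul_le_mul_of_nonneg_left (hi' s hs) (norm_nonneg _)
      · simp [image_eq_zero_of_notMem_tsupport hs]
    have h3 : ‖k s‖ ≤ ‖k s - g s‖ + ‖g s‖ := by simpa using norm_add_le (k s - g s) (g s)
    calc _ ≤ (‖k s - g s‖ + ‖g s‖) * ‖D i (φ s)‖ := by gcongr
      _ = ‖k s - g s‖ * ‖D i (φ s)‖ + ‖g s‖ * ‖D i (φ s)‖ := by ring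
      _ ≤ _ := by gcongr
  have hkg : MeasureTheory.Integrable fun s => ‖k s - g s‖ * (C * M) :=
    (hk.sub hgi).norm.mul_const _
  have hg' : MeasureTheory.Integrable fun s => ‖g s‖ * (ε / (4 * (I + 1))) := hgi.norm.mul_const _
  have hle : ∫ s, ‖k s‖ * ‖D i (φ s)‖ ≤
      (∫ s, ‖k s - g s‖) * (C * M) + I * (ε / (4 * (I + 1))) := by
    rw [hI, ← MeasureTheory.integral_mul_const, ← MeasureTheory.integral_mul_const,
      ← MeasureTheory.integral_add hkg hg']
    exact MeasureTheory.integral_mono_of_nonneg (.of_forall fun s => by positivity)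
      (hkg.add hg') (.of_forall hb)
  have h0 : 0 ≤ ∫ s, ‖k s‖ * ‖D i (φ s)‖ :=
    MeasureTheory.integral_nonneg fun s => by positivity
  rw [dist_zero_right, Real.norm_of_nonneg h0]
  have e1 : (∫ s, ‖k s - g s‖) * (C * M) ≤ ε / 4 := by
    calc _ ≤ ε / (4 * (C * M + 1)) * (C * M) := by gcongr
      _ = ε / 4 * (C * M / (C * M + 1)) := by field_simp
      _ ≤ ε / 4 * 1 := by
        gcongr
        rw [div_le_one (by positivity)]
        linarith
      _ = ε / 4 := mul_one _
  have e2 : I * (ε / (4 * (I + 1))) ≤ ε / 4 := by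
    calc _ = ε / 4 * (I / (I + 1)) := by field_simp
      _ ≤ ε / 4 * 1 := by
        gcongr
        rw [div_le_one (by positivity)]
        linarith
      _ = ε / 4 := mul_one _
  linarith

/-- Gaussian averages of `γ_s D_i γ_{-s}` tend strongly to zero if the `D_i` do. -/
theorem tendsto_gaussian_conj {γ : OneParamRep X} (hγ : γ.StronglyContinuous)
    {D : ι → X →L[ℂ] X} {C : ℝ} (hC : ∀ᶠ i in l, ‖D i‖ ≤ C)
    (hD : ∀ x, Filter.Tendsto (fun i => D i x) l (𝓝 0)) (w : ℂ) (x : X) :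
    Filter.Tendsto (fun i => ∫ s : ℝ, Complex.exp (-((s : ℂ) - w) ^ 2) • γ s (D i (γ (-s) x))) l
      (𝓝 0) := by
  have hφ : Continuous fun s : ℝ => γ (-s) x := (hγ x).comp continuous_neg
  refine squeeze_zero_norm (fun i => ?_) (tendsto_integral_mul_norm_apply hC hD hφ
    (fun s => γ.norm_apply_le (-s) x) (integrable_gaussian w))
  refine MeasureTheory.norm_integral_le_of_norm_le ?_ (.of_forall fun s => ?_)
  · refine ((integrable_gaussian w).norm.mul_const (‖D i‖ * ‖x‖)).mono'
      (by fun_prop) (.of_forall fun s => ?_)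
    rw [norm_mul, norm_norm, norm_norm]
    exact mul_le_mul_of_nonneg_left ((D i).le_opNorm_of_le (γ.norm_apply_le _ _)) (norm_nonneg _)
  · rw [norm_smul]
    exact mul_le_mul_of_nonneg_left (γ.norm_apply_le _ _) (norm_nonneg _)

end Averages

/-! ### Multipliers -/

section Multipliers

variable {A : Type*} [NonUnitalCStarAlgebra A] {α β γ : OneParamRep A}

/-- Both sides agree after left multiplication by any `α_t(y)`, and these elements exhaust `A`. -/
theorem map_mul_of_apply_mul_apply (hm : ∀ (t : ℝ) (a b : A), α t a * γ t b = α t (a * b)) (t : ℝ) (b c : A) :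
    γ t (b * c) = γ t b * γ t c := by
  rw [← sub_eq_zero]
  refine eq_zero_of_forall_mul fun x => ?_
  rw [← α.apply_neg_apply t x, mul_sub, ← mul_assoc, hm, hm, hm, mul_assoc, sub_self]

/-- The map `m ↦ α_t m γ_{-t}` on multipliers that extends `α_t`. -/
noncomputable def conjMultiplier
    (hm : ∀ (t : ℝ) (a b : A), β t b * α t a = α t (b * a) ∧ α t a * γ t b = α t (a * b)) (t : ℝ) :
    𝓜(ℂ, A) →ₗ[ℂ] 𝓜(ℂ, A) where
  toFun m :=
    { fst := (α t).comp (m.fst.comp (γ (-t)))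
      snd := (α t).comp (m.snd.comp (β (-t)))
      central := fun x y => by
        simp only [ContinuousLinearMap.comp_apply]
        nth_rw 2 [← β.apply_neg_apply t x]
        nth_rw 1 [← γ.apply_neg_apply t y]
        rw [(hm t _ _).1, (hm t _ _).2, m.central] }
  map_add' m n := multiplier_ext (fun b => by simp) (fun b => by simp)
  map_smul' c m := multiplier_ext (fun b => by simp) (fun b => by simp)

theorem isStrictExtension_conjMultiplier
    (hm : ∀ (t : ℝ) (a b : A), β t b * α t a = α t (b * a) ∧ α t a * γ t b = α t (a * b)) (t : ℝ) :
    IsStrictExtension (α t) (conjMultiplier hm t) where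
  extends_coe a := by
    refine multiplier_ext (fun b => ?_) (fun b => ?_)
    · simp [conjMultiplier, ← (hm t _ _).2, γ.apply_neg_apply]
    · simp [conjMultiplier, ← (hm t _ _).1, β.apply_neg_apply]
  continuousOn_bounded S _ := by
    refine Continuous.continuousOn (continuous_iff_continuousAt.2 fun m => ?_)
    have hid : Filter.Tendsto (fun n => toStrict A ((toStrict A).symm n)) (𝓝 m)
        (𝓝 (toStrict A ((toStrict A).symm m))) := by
      simp only [LinearEquiv.apply_symm_apply]
      exact Filter.tendsto_id
    rw [tendsto_strict_iff] at hid
    exact tendsto_strict_iff.2 ⟨fun b => ((α t).continuous.tendsto _).comp (hid.1 _),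
      fun b => ((α t).continuous.tendsto _).comp (hid.2 _)⟩

theorem strictExt_eq (hα : α.SemiMultiplicative)
    (hm : ∀ (t : ℝ) (a b : A), β t b * α t a = α t (b * a) ∧ α t a * γ t b = α t (a * b)) (t : ℝ) :
    strictExt hα t = conjMultiplier hm t :=
  (isStrictExtension_strictExt hα t).unique (isStrictExtension_conjMultiplier hm t)

/-- The left action of multipliers, as a linear isometry. -/
noncomputable def fstIsometry (A : Type*) [NonUnitalCStarAlgebra A] :
    𝓜(ℂ, A) →ₗᵢ[ℂ] (A →L[ℂ] A) where
  toFun m := m.fst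
  map_add' _ _ := rfl
  map_smul' _ _ := rfl
  norm_map' m := DoubleCentralizer.norm_fst m

/-- The right action of multipliers, as a linear isometry. -/
noncomputable def sndIsometry (A : Type*) [NonUnitalCStarAlgebra A] :
    𝓜(ℂ, A) →ₗᵢ[ℂ] (A →L[ℂ] A) where
  toFun m := m.snd
  map_add' _ _ := rfl
  map_smul' _ _ := rfl
  norm_map' m := DoubleCentralizer.norm_snd m

/-- Formally `α_z(m c) = n γ_z(c)`: the left actions of a strict continuation continue `α_t m
γ_{-t}`. -/
theorem fst_mem_analyticGraph (hα : α.SemiMultiplicative)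
    (hm : ∀ (t : ℝ) (a b : A), β t b * α t a = α t (b * a) ∧ α t a * γ t b = α t (a * b)) {z : ℂ}
    {m n : 𝓜(ℂ, A)} (hmn : (toStrict A m, toStrict A n) ∈ strictGraph hα z) {c c' : A}
    (hc : (c, c') ∈ analyticGraph γ z) : (m.fst c, n.fst c') ∈ analyticGraph α z := by
  obtain ⟨f, hf, hfz⟩ := hmn
  obtain rfl : f z = n := (toStrict A).injective hfz
  exact apply_mem_analyticGraph (L := fun y => (f y).fst)
    (fun x y hy => (tendsto_strict_iff.1 (hf.continuousOn y hy)).1 x)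
    (fun y hy => ((fstIsometry A).toContinuousLinearMap.analyticAt _).comp (hf.analyticOn y hy))
    (fun t x => by rw [← hf.eq_real, strictExt_eq hα hm]; rfl) hc

theorem snd_mem_analyticGraph (hα : α.SemiMultiplicative)
    (hm : ∀ (t : ℝ) (a b : A), β t b * α t a = α t (b * a) ∧ α t a * γ t b = α t (a * b)) {z : ℂ}
    {m n : 𝓜(ℂ, A)} (hmn : (toStrict A m, toStrict A n) ∈ strictGraph hα z) {c c' : A}
    (hc : (c, c') ∈ analyticGraph β z) : (m.snd c, n.snd c') ∈ analyticGraph α z := by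
  obtain ⟨f, hf, hfz⟩ := hmn
  obtain rfl : f z = n := (toStrict A).injective hfz
  exact apply_mem_analyticGraph (L := fun y => (f y).snd)
    (fun x y hy => (tendsto_strict_iff.1 (hf.continuousOn y hy)).2 x)
    (fun y hy => ((sndIsometry A).toContinuousLinearMap.analyticAt _).comp (hf.analyticOn y hy))
    (fun t x => by rw [← hf.eq_real, strictExt_eq hα hm]; rfl) hc

theorem continuous_strict_fst (b : A) :
    Continuous fun m : StrictMultiplier A => ((toStrict A).symm m).fst b :=
  (continuous_apply b).comp (continuous_fst.comp (continuous_induced_dom (f := actions A)))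

theorem continuous_strict_snd (b : A) :
    Continuous fun m : StrictMultiplier A => ((toStrict A).symm m).snd b :=
  (continuous_apply b).comp (continuous_snd.comp (continuous_induced_dom (f := actions A)))

/-! ### Strict closedness of the graph -/

/-- The strict analytic continuation has a strictly closed graph. -/
theorem isClosed_strictGraph (hα : α.SemiMultiplicative) (z : ℂ) :
    IsClosed (strictGraph hα z : Set (StrictMultiplier A × StrictMultiplier A)) := by
  obtain ⟨β, γ, hβ, hγ, hm⟩ := id hα
  refine isClosed_of_closure_subset fun p hp => ?_
  obtain ⟨a, b⟩ := p
  obtain ⟨a, rfl⟩ := (toStrict A).surjective a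
  obtain ⟨b, rfl⟩ := (toStrict A).surjective b
  -- For fixed `(c, c')` the relation survives strict limits, as the graph of `α_z` is norm closed.
  have hL : ∀ c c', (c, c') ∈ analyticGraph γ z → (a.fst c, b.fst c') ∈ analyticGraph α z := by
    intro c c' hc
    have := map_mem_closure (f := fun q : StrictMultiplier A × StrictMultiplier A =>
        (((toStrict A).symm q.1).fst c, ((toStrict A).symm q.2).fst c'))
      (((continuous_strict_fst c).comp continuous_fst).prodMk
        ((continuous_strict_fst c').comp continuous_snd)) hp
      (t := analyticGraph α z) fun q hq => fst_mem_analyticGraph hα hm (by simpa using hq) hc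
    rw [(isClosed_analyticGraph α z).closure_eq] at this
    exact this
  have hR : ∀ c c', (c, c') ∈ analyticGraph β z → (a.snd c, b.snd c') ∈ analyticGraph α z := by
    intro c c' hc
    have := map_mem_closure (f := fun q : StrictMultiplier A × StrictMultiplier A =>
        (((toStrict A).symm q.1).snd c, ((toStrict A).symm q.2).snd c'))
      (((continuous_strict_snd c).comp continuous_fst).prodMk
        ((continuous_strict_snd c').comp continuous_snd)) hp
      (t := analyticGraph α z) fun q hq => snd_mem_analyticGraph hα hm (by simpa using hq) hc
    rw [(isClosed_analyticGraph α z).closure_eq] at this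
    exact this
  obtain ⟨L, hLc, hLa, hLr, hLz⟩ := exists_intertwiner_continuation hγ α hL
  obtain ⟨R, hRc, hRa, hRr, hRz⟩ := exists_intertwiner_continuation hβ α hR
  -- On `ℝ` the operators `L` and `R` are the two actions of one multiplier; uniqueness of
  -- continuation extends the compatibility to the strip.
  have hcentral : ∀ y ∈ strip z, ∀ x d, R y x * d = x * L y d := by
    intro y hy x d
    have := eqOn_zero_strip (f := fun y => R y x * d - x * L y d) (z := z)
      (((hRc x).mul continuousOn_const).sub (continuousOn_const.mul (hLc d)))
      (fun w hw => by
        have h1 : AnalyticAt ℂ (fun w => R w x) w :=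
          ((ContinuousLinearMap.apply ℂ A x).analyticAt _).comp (hRa w hw)
        have h2 : AnalyticAt ℂ (fun w => L w d) w :=
          ((ContinuousLinearMap.apply ℂ A d).analyticAt _).comp (hLa w hw)
        exact ((((ContinuousLinearMap.mul ℂ A).flip d).analyticAt _).comp h1).sub
          (((ContinuousLinearMap.mul ℂ A x).analyticAt _).comp h2))
      (fun t => by
        rw [sub_eq_zero, hLr, hRr]
        exact (conjMultiplier hm t a).central x d) hy
    exact sub_eq_zero.1 this
  have hex : ∀ y, ∃ m : 𝓜(ℂ, A), y ∈ strip z → m.fst = L y ∧ m.snd = R y := by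
    intro y
    by_cases hy : y ∈ strip z
    · exact ⟨{ fst := L y, snd := R y, central := hcentral y hy }, fun _ => ⟨rfl, rfl⟩⟩
    · exact ⟨0, fun h => absurd h hy⟩
  choose f hf using hex
  refine ⟨f, ⟨fun y hy => tendsto_strict_iff.2 ⟨fun x => ?_, fun x => ?_⟩, ?_, fun t => ?_⟩, ?_⟩
  · exact (hLc x).congr (fun w hw => by rw [(hf w hw).1]) y hy
  · exact (hRc x).congr (fun w hw => by rw [(hf w hw).2]) y hy
  · rw [Complex.analyticOnNhd_iff_differentiableOn isOpen_interior]
    intro y hy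
    -- The left action alone determines the norm of a multiplier, so analyticity of `L` suffices.
    refine DifferentiableAt.differentiableWithinAt ((fstIsometry A).differentiableAt_of_comp ?_)
    refine (hLa y hy).differentiableAt.congr_of_eventuallyEq ?_
    filter_upwards [isOpen_interior.mem_nhds hy] with w hw
    exact (hf w (interior_subset hw)).1
  · have ht := hf t (ofReal_mem_strip z t)
    rw [strictExt_eq hα hm]
    refine multiplier_ext (fun x => ?_) (fun x => ?_)
    · rw [ht.1, hLr]; rfl
    · rw [ht.2, hRr]; rfl
  · have hz := hf z (self_mem_strip z)
    refine congrArg (toStrict A) (multiplier_ext (fun x => ?_) (fun x => ?_))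
    · rw [hz.1, hLz]
    · rw [hz.2, hRz]

/-! ### The core -/

/-- Multiplicativity gives `γ_s(e) x = γ_s(e γ_{-s}(x))`. The error is then a Gaussian average of
conjugates of left multiplication by `e` minus the identity, which tends strongly to 0. -/
theorem tendsto_gaussianSmear_mul {γ : OneParamRep A} (hγ : γ.StronglyContinuous)
    (hmul : ∀ (t : ℝ) (a b : A), γ t (a * b) = γ t a * γ t b) {l : Filter A}
    (hl : l.IsApproximateUnit) (hl₁ : ∀ᶠ e in l, ‖e‖ ≤ 1) (w : ℂ) (x : A) :
    Filter.Tendsto (fun e => gaussianSmear γ e w * x) l (𝓝 (gaussianMass • x)) := by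
  have key := tendsto_gaussian_conj hγ (l := l) (C := 1 + 1)
    (D := fun e => ContinuousLinearMap.mul ℂ A e - ContinuousLinearMap.id ℂ A)
    (hl₁.mono fun e he => (norm_sub_le _ _).trans (add_le_add
      ((ContinuousLinearMap.opNorm_mul_apply_le ℂ A e).trans he) ContinuousLinearMap.norm_id_le))
    (fun x => by simpa using (hl.tendsto_mul_right x).sub_const x) w x
  rw [← tendsto_sub_nhds_zero_iff]
  refine key.congr fun e => ?_
  have i1 := integrable_gaussian_smul (hγ e) (fun s => γ.norm_apply_le s e) w
  have e1 : gaussianSmear γ e w * x =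
      ∫ s : ℝ, (Complex.exp (-((s : ℂ) - w) ^ 2) • γ s e) * x :=
    (((ContinuousLinearMap.mul ℂ A).flip x).integral_comp_comm i1).symm
  have i2 : MeasureTheory.Integrable
      fun s : ℝ => (Complex.exp (-((s : ℂ) - w) ^ 2) • γ s e) * x :=
    ((ContinuousLinearMap.mul ℂ A).flip x).integrable_comp i1
  rw [e1, ← integral_gaussian_shift w, ← integral_smul_const,
    ← MeasureTheory.integral_sub i2 ((integrable_gaussian w).smul_const x)]
  congr 1
  ext s
  simp [hmul, γ.apply_neg_apply, smul_sub]
  exact (smul_mul_assoc _ _ _).symm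

theorem tendsto_mul_gaussianSmear {γ : OneParamRep A} (hγ : γ.StronglyContinuous)
    (hmul : ∀ (t : ℝ) (a b : A), γ t (a * b) = γ t a * γ t b) {l : Filter A}
    (hl : l.IsApproximateUnit) (hl₁ : ∀ᶠ e in l, ‖e‖ ≤ 1) (w : ℂ) (x : A) :
    Filter.Tendsto (fun e => x * gaussianSmear γ e w) l (𝓝 (gaussianMass • x)) := by
  have key := tendsto_gaussian_conj hγ (l := l) (C := 1 + 1)
    (D := fun e => (ContinuousLinearMap.mul ℂ A).flip e - ContinuousLinearMap.id ℂ A)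
    (hl₁.mono fun e he => (norm_sub_le _ _).trans (add_le_add
      ((ContinuousLinearMap.opNorm_le_bound _ (norm_nonneg e) fun y => by
        simpa [mul_comm] using norm_mul_le y e).trans he) ContinuousLinearMap.norm_id_le))
    (fun x => by simpa using (hl.tendsto_mul_left x).sub_const x) w x
  rw [← tendsto_sub_nhds_zero_iff]
  refine key.congr fun e => ?_
  have i1 := integrable_gaussian_smul (hγ e) (fun s => γ.norm_apply_le s e) w
  have e1 : x * gaussianSmear γ e w =
      ∫ s : ℝ, x * (Complex.exp (-((s : ℂ) - w) ^ 2) • γ s e) :=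
    ((ContinuousLinearMap.mul ℂ A x).integral_comp_comm i1).symm
  have i2 : MeasureTheory.Integrable
      fun s : ℝ => x * (Complex.exp (-((s : ℂ) - w) ^ 2) • γ s e) :=
    (ContinuousLinearMap.mul ℂ A x).integrable_comp i1
  rw [e1, ← integral_gaussian_shift w, ← integral_smul_const,
    ← MeasureTheory.integral_sub i2 ((integrable_gaussian w).smul_const x)]
  congr 1
  ext s
  simp [hmul, γ.apply_neg_apply, smul_sub]
  exact (mul_smul_comm _ _ _).symm

/-- Since `(m b) x = m (b x)` and `x (m b) = (x m) b`, no norm bound on the `b i` is needed. -/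
theorem tendsto_embed_fst {ι : Type*} {l : Filter ι} {b : ι → A}
    (h₁ : ∀ x, Filter.Tendsto (fun i => b i * x) l (𝓝 x))
    (h₂ : ∀ x, Filter.Tendsto (fun i => x * b i) l (𝓝 x)) (m : 𝓜(ℂ, A)) :
    Filter.Tendsto (fun i => embed A (m.fst (b i))) l (𝓝 (toStrict A m)) := by
  simp only [embed_apply]
  rw [tendsto_strict_iff]
  refine ⟨fun x => ?_, fun x => ?_⟩
  · simp only [DoubleCentralizer.coe_fst, ContinuousLinearMap.mul_apply', ← fst_mul]
    exact (m.fst.continuous.tendsto x).comp (h₁ x)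
  · simp only [DoubleCentralizer.coe_snd, ContinuousLinearMap.flip_apply,
      ContinuousLinearMap.mul_apply', ← m.central]
    exact h₂ _

theorem strictGraph_le_topologicalClosure (hα : α.SemiMultiplicative) (z : ℂ) :
    strictGraph hα z ≤
      ((analyticGraph α z).map ((embed A).prodMap (embed A))).topologicalClosure := by
  obtain ⟨β, γ, hβ, hγ, hm⟩ := id hα
  rintro ⟨m, n⟩ hmn
  obtain ⟨m, rfl⟩ := (toStrict A).surjective m
  obtain ⟨n, rfl⟩ := (toStrict A).surjective n
  let _ := CStarAlgebra.spectralOrder A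
  let _ := CStarAlgebra.spectralOrderedRing A
  have hu := CStarAlgebra.increasingApproximateUnit A
  have := hu.neBot
  have hmul := map_mul_of_apply_mul_apply fun t a b => (hm t a b).2
  -- The centre `w` is 0 for the argument and `z` for the value: `γ_z` maps `b 0 e` to `b z e`.
  set b : ℂ → A → A := fun w e => gaussianMass⁻¹ • gaussianSmear γ e w with hb
  have h₁ : ∀ w x, Filter.Tendsto (fun e => b w e * x) (CStarAlgebra.approximateUnit A) (𝓝 x) := by
    intro w x
    have := (tendsto_gaussianSmear_mul hγ hmul hu.toIsApproximateUnit
      hu.eventually_norm w x).const_smul gaussianMass⁻¹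
    rw [inv_smul_smul₀ gaussianMass_ne_zero] at this
    exact this.congr fun e => (smul_mul_assoc _ _ _).symm
  have h₂ : ∀ w x, Filter.Tendsto (fun e => x * b w e) (CStarAlgebra.approximateUnit A) (𝓝 x) := by
    intro w x
    have := (tendsto_mul_gaussianSmear hγ hmul hu.toIsApproximateUnit
      hu.eventually_norm w x).const_smul gaussianMass⁻¹
    rw [inv_smul_smul₀ gaussianMass_ne_zero] at this
    exact this.congr fun e => (mul_smul_comm _ _ _).symm
  refine mem_closure_of_tendsto
    ((tendsto_embed_fst (h₁ 0) (h₂ 0) m).prodMk_nhds (tendsto_embed_fst (h₁ z) (h₂ z) n))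
    (.of_forall fun e => ⟨(m.fst (b 0 e), n.fst (b z e)), ?_, rfl⟩)
  refine fst_mem_analyticGraph hα hm hmn ?_
  have := ((isEntireOrbit_gaussianSmear hγ e).const_smul gaussianMass⁻¹).mem_analyticGraph 0 z
  simpa [hb] using this

theorem map_analyticGraph_le_strictGraph (hα : α.SemiMultiplicative) (z : ℂ) :
    (analyticGraph α z).map ((embed A).prodMap (embed A)) ≤ strictGraph hα z := by
  rintro _ ⟨⟨a, a'⟩, ⟨h, hh, hhz⟩, rfl⟩
  simp only at hh hhz
  subst hhz
  refine ⟨fun y => (h y : 𝓜(ℂ, A)), ⟨fun y hy => tendsto_strict_iff.2 ⟨fun x => ?_, fun x => ?_⟩,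
    ?_, fun t => ?_⟩, rfl⟩
  · exact (hh.continuousOn y hy).mul continuousWithinAt_const
  · exact continuousWithinAt_const.mul (hh.continuousOn y hy)
  · rw [Complex.analyticOnNhd_iff_differentiableOn isOpen_interior]
    intro y hy
    refine DifferentiableAt.differentiableWithinAt ((fstIsometry A).differentiableAt_of_comp ?_)
    exact (ContinuousLinearMap.mul ℂ A).differentiableAt.comp y (hh.analyticOn y hy).differentiableAt
  · rw [← hh.eq_real]
    exact (isStrictExtension_strictExt hα t).extends_coe a

/-! ### From graphs to operators: closure and core -/

theorem topologicalClosure_embedOperator_graph (hα : α.SemiMultiplicative) (z : ℂ) :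
    (embedOperator (analyticCont α z)).graph.topologicalClosure = (strictCont hα z).graph := by
  rw [embedOperator_graph, analyticCont_graph, strictCont_graph]
  exact le_antisymm (Submodule.topologicalClosure_minimal _ (map_analyticGraph_le_strictGraph hα z)
    (isClosed_strictGraph hα z)) (strictGraph_le_topologicalClosure hα z)

theorem isClosable_embedOperator (hα : α.SemiMultiplicative) (z : ℂ) :
    (embedOperator (analyticCont α z)).IsClosable :=
  ⟨_, topologicalClosure_embedOperator_graph hα z⟩

theorem closure_embedOperator (hα : α.SemiMultiplicative) (z : ℂ) :
    (embedOperator (analyticCont α z)).closure = strictCont hα z :=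
  LinearPMap.eq_of_eq_graph ((isClosable_embedOperator hα z).graph_closure_eq_closure_graph.symm.trans
    (topologicalClosure_embedOperator_graph hα z))

theorem embedOperator_domain (T : A →ₗ.[ℂ] A) :
    (embedOperator T).domain = T.domain.map (embed A) := by
  rw [← LinearPMap.graph_map_fst_eq_domain, ← LinearPMap.graph_map_fst_eq_domain,
    embedOperator_graph]
  ext x
  simp

theorem embedOperator_le_strictCont (hα : α.SemiMultiplicative) (z : ℂ) :
    embedOperator (analyticCont α z) ≤ strictCont hα z := by
  rw [← closure_embedOperator hα z]
  exact LinearPMap.le_closure _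

theorem hasCore_strictCont (hα : α.SemiMultiplicative) (z : ℂ) :
    (strictCont hα z).HasCore ((analyticCont α z).domain.map (embed A)) := by
  have hle := embedOperator_le_strictCont hα z
  rw [← embedOperator_domain]
  refine ⟨hle.1, ?_⟩
  -- The restriction to `D(α_z)` is `α_z` itself, so the core property reduces to the computed
  -- closure.
  have : (strictCont hα z).domRestrict (embedOperator (analyticCont α z)).domain =
      embedOperator (analyticCont α z) := by
    have hle' : embedOperator (analyticCont α z) ≤
        (strictCont hα z).domRestrict (embedOperator (analyticCont α z)).domain := by
      refine ⟨le_inf le_rfl hle.1, fun x y hxy => ?_⟩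
      rw [hle.2 (show (x : StrictMultiplier A) = (⟨y, y.2.2⟩ : (strictCont hα z).domain) from hxy)]
      exact (LinearPMap.domRestrict_apply rfl).symm
    exact (LinearPMap.eq_of_le_of_domain_eq hle' (inf_eq_left.2 hle.1).symm).symm
  rw [this, closure_embedOperator hα z]

end Multipliers

end StrictContinuation

/-- Let `α` be a strongly continuous, semi-multiplicative one-parameter representation on a
C⋆-algebra `A`. For every `z`, the strict analytic continuation at `z` is a strictly closed operator
in `M(A)`, has `D(α_z)` as a strict core, and equals the strict closure of the (strictly closable)
operator `α_z`. -/
theorem theorem2p4 {A : Type*} [NonUnitalCStarAlgebra A] (α : StrictContinuation.OneParamRep A)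
    (hcont : α.StronglyContinuous) (hα : α.SemiMultiplicative) (z : ℂ) :
    (StrictContinuation.strictCont hα z).IsClosed ∧
    (StrictContinuation.strictCont hα z).HasCore
      ((StrictContinuation.analyticCont α z).domain.map (StrictContinuation.embed A)) ∧
    (StrictContinuation.embedOperator (StrictContinuation.analyticCont α z)).IsClosable ∧
    (StrictContinuation.embedOperator (StrictContinuation.analyticCont α z)).closure =
      StrictContinuation.strictCont hα z := by
  refine ⟨?_, StrictContinuation.hasCore_strictCont hα z,
    StrictContinuation.isClosable_embedOperator hα z,
    StrictContinuation.closure_embedOperator hα z⟩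
  rw [LinearPMap.IsClosed, StrictContinuation.strictCont_graph]
  exact StrictContinuation.isClosed_strictGraph hα z
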